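/- \textbf{Conventions.} All oriented matroids are on finite sets. For an oriented matroid $N$ and a set $A$ of elements, $-_AN$ is the reorientation of $N$ on $A$; reorientations are indexed by the sets $A$. A signed set is positive if it has no negative element, and becomes positive in $-_AN$ if it has no negative element after reversing its signs on $A$; $X\setminus e$ is $X$ with $e$ removed. $N$ is acyclic if it has no positive circuit and totally cyclic if every element lies in a positive circuit. For a basis $B$: for $e\notin B$, $C(B;e)$ is the signed circuit with support contained in $B\cup e$ and positive at $e$; for $b\in B$, $C^*(B;b)$ is the signed cocircuit whose support is the complement of the closure of $B\setminus b$, positive at $b$. Let $M$ be an oriented matroid on $E$ and let $f\neq g$ be elements not in $E$. A \emph{generic extension-lifting} of $M$ with respect to $(f,g)$ is an oriented matroid $\overline M$ on $E\cup\{f,g\}$ such that $\overline M/g\backslash f=M$, the circuits of $\overline M$ containing $f$ are exactly the sets $B\cup f$ with $B$ a basis of $\overline M\backslash f$, and the cocircuits of $\overline M$ containing $g$ are exactly the sets $((E\cup f)\setminus B)\cup g$ with $B$ a basis of $\overline M/g$. It is \emph{compliant} if no signed cocircuit of $\overline M$ is positive at $g$ and negative at $f$. A \emph{bounded region} of $\overline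 M$ with respect to $(f,g)$ is a reorientation $-_A\overline M$, $A\subseteq E$, such that $-_A\overline M\backslash f$ is acyclic and $-_A\overline M/g$ is totally cyclic. A basis $B$ of $-_A\overline M$ is an \emph{optimal basis} of the program $(-_A\overline M,g,f)$ if $g\in B$, $f\notin B$ and, computed in $-_A\overline M$, $C^*(B;g)\setminus f$ and $C(B;f)\setminus g$ are positive. For a linear ordering of the ground set with smallest element $p$, a basis $B$ of an oriented matroid is \emph{fully optimal} if for every $e\notin B$ the signs of $e$ and $\min C(B;e)$ in $C(B;e)$ are opposite, and for every $b\in B\setminus p$ the signs of $b$ and $\min C^*(B;b)$ in $C^*(B;b)$ are opposite. The \emph{active bijection} (bounded case) of $\overline M$ for this ordering sends each reorientation $-_A\overline M$ with $p\notin A$ that is acyclic and all of whose positive cocircuits contain $p$ to its fully optimal basis. \textbf{Proposition.} Let $\overline M$ be a generic extension-lifting of $M$ with respect to $(f,g)$. (1) For every bounded region $-_A\overline M$ of $\overline M$ with respect to $(f,g)$ there is a unique basis $B$ of $\overline M$ containing $g$ but not $f$ such that $C^*(B;g)\setminus f$ and $C(B;f)\setminus g$ are both positive in $-_A\overline M$.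 (2) For every basis $B$ of $\overline M$ containing $g$ but not $f$ there is a unique $A\subseteq E$ such that $C^*(B;g)\setminus f$ and $C(B;f)\setminus g$ are both positive in $-_A\overline M$, and this $-_A\overline M$ is a bounded region of $\overline M$ with respect to $(f,g)$. (3) This gives a bijection between the bounded regions of $\overline M$ with respect to $(f,g)$ and the bases of $\overline M$ containing $g$ but not $f$. The basis associated with $-_A\overline M$ is the unique optimal basis of the program $(-_A\overline M,g,f)$. If $\overline M$ is compliant then, for every linear ordering with $g<f<E$, it is also the unique fully optimal basis of $-_A\overline M$, and the bijection is equal to the active bijection of $\overline M$ (same domain and same values). (4) Whether or not $\overline M$ is compliant, there is a compliant generic extension-lifting $\overline M'$ of $M$ with respect to $(f,g)$, obtained by replacing $f$ by another element (again called $f$) with the same intersection with $g$: $\overline M'\backslash f=\overline M\backslash f$ and $\overline M'/g=\overline M/g$. For every such $\overline M'$, the sets $A$ giving bounded regions, the bases containing $g$ but not $f$, and the bijection between them are the same for $\overline M'$ as for $\overline M$. -/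

import Mathlib

/-! Oriented matroids on finite sets. A signed subset of a set is a map to the three signs
`0`, `1`, `-1`; its underlying (unsigned) set is its support. -/

/-- `S` is a signature of the family `P` of sets: every set in the family carries exactly two
signed sets of `S`, which are opposite to each other. -/
structure IsSignature {α : Type*} (S : Set (α → SignType)) (P : Set α → Prop) : Prop where
  support_iff : ∀ C : Set α, P C ↔ ∃ X ∈ S, Function.support X = C
  neg_mem : ∀ X ∈ S, -X ∈ S
  eq_or_eq_neg : ∀ X ∈ S, ∀ Y ∈ S, Function.support X = Function.support Y → X = Y ∨ X = -Y

/-- Orthogonality of signed sets: if the supports meet, then there is an element where the two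
signs agree and an element where they are opposite. -/
def SignedOrthogonal {α : Type*} (X Y : α → SignType) : Prop :=
  (∃ e, X e * Y e ≠ 0) → (∃ e, X e * Y e = 1) ∧ (∃ e, X e * Y e = -1)

/-- An oriented matroid on a finite set, as a dual pair (Bland and Las Vergnas): a matroid
together with a signature of its circuits and a signature of its cocircuits, such that every
signed circuit is orthogonal to every signed cocircuit. -/
@[ext]
structure OrientedMatroid (α : Type*) where
  toMatroid : Matroid α
  circuits : Set (α → SignType)
  cocircuits : Set (α → SignType)
  ground_finite : toMatroid.E.Finite
  circuits_sig : IsSignature circuits toMatroid.IsCircuit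
  cocircuits_sig : IsSignature cocircuits toMatroid.IsCocircuit
  orthogonal : ∀ X ∈ circuits, ∀ Y ∈ cocircuits, SignedOrthogonal X Y

/-! Helper facts on matroids and signatures. -/

theorem Matroid.exists_isCocircuit_inter_eq_pair {α : Type*} {M : Matroid α} {K : Set α}
    (hK : M.IsCircuit K) {a b : α} (ha : a ∈ K) (hb : b ∈ K) (hab : a ≠ b) :
    ∃ D, M.IsCocircuit D ∧ D ∩ K = {a, b} := by
  obtain ⟨B, hB, hKB⟩ := (hK.sdiff_singleton_indep ha).exists_isBase_superset
  have haB : a ∉ B := by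
    intro h
    refine hK.not_indep (hB.indep.subset fun x hx => ?_)
    by_cases hxa : x = a
    · exact hxa ▸ h
    · exact hKB ⟨hx, hxa⟩
  have hbB : b ∈ B := hKB ⟨hb, fun h => hab h.symm⟩
  have hKi : K ⊆ insert a B := by
    intro x hx
    by_cases hxa : x = a
    · exact Or.inl hxa
    · exact Or.inr (hKB ⟨hx, hxa⟩)
  have hfc : K = M.fundCircuit a B := hK.eq_fundCircuit_of_subset hB.indep hKi
  refine ⟨M.fundCocircuit b B, Matroid.fundCocircuit_isCocircuit hbB hB, ?_⟩
  ext x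
  constructor
  · rintro ⟨hxD, hxK⟩
    by_cases hxa : x = a
    · exact Or.inl hxa
    · have hxB : x ∈ B := hKB ⟨hxK, hxa⟩
      rcases M.fundCocircuit_subset_insert_compl b B hxD with h | h
      · exact Or.inr h
      · exact absurd hxB h.2
  · rintro (rfl | h)
    · exact ⟨hB.mem_fundCocircuit_iff_mem_fundCircuit.2 (hfc ▸ hb), ha⟩
    · rw [Set.mem_singleton_iff] at h
      subst h
      exact ⟨M.mem_fundCocircuit x B, hb⟩

theorem SignedOrthogonal.mul_eq_neg {α : Type*} {X Y : α → SignType} (h : SignedOrthogonal X Y)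
    {a b : α} (hab : Function.support X ∩ Function.support Y = {a, b}) :
    X a * Y a = -(X b * Y b) := by
  have hmem : ∀ e, X e * Y e ≠ 0 → e = a ∨ e = b := by
    intro e he
    have : e ∈ Function.support X ∩ Function.support Y :=
      ⟨fun h0 => he (by rw [h0, zero_mul]), fun h0 => he (by rw [h0, mul_zero])⟩
    rw [hab] at this
    exact this
  have ha : a ∈ Function.support X ∩ Function.support Y := by rw [hab]; exact Or.inl rfl
  obtain ⟨⟨p, hp⟩, q, hq⟩ := h ⟨a, mul_ne_zero ha.1 ha.2⟩
  have hp' := hmem p (by rw [hp]; decide)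
  have hq' := hmem q (by rw [hq]; decide)
  rcases hp' with rfl | rfl <;> rcases hq' with rfl | rfl
  · rw [hp] at hq; exact absurd hq (by decide)
  · rw [hp, hq]; decide
  · rw [hp, hq]
  · rw [hp] at hq; exact absurd hq (by decide)

namespace OrientedMatroid

variable {α : Type*}

/-- The dual oriented matroid. -/
def dual (M : OrientedMatroid α) : OrientedMatroid α where
  toMatroid := M.toMatroid.dual
  circuits := M.cocircuits
  cocircuits := M.circuits
  ground_finite := M.ground_finite
  circuits_sig := M.cocircuits_sig
  cocircuits_sig := by
    have h : M.toMatroid.dual.IsCocircuit = M.toMatroid.IsCircuit := by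
      funext C; simp
    rw [h]; exact M.circuits_sig
  orthogonal := by
    intro X hX Y hY h
    have h' := M.orthogonal Y hY X hX
    simp only [SignedOrthogonal, mul_comm (Y _)] at h'
    exact h' h

open Classical in
/-- Reversal of the signs of a signed set on `A`. -/
noncomputable def signReorient (A : Set α) (X : α → SignType) : α → SignType :=
  fun e => if e ∈ A then -X e else X e

theorem signReorient_signReorient (A : Set α) (X : α → SignType) :
    signReorient A (signReorient A X) = X := by
  funext e; by_cases h : e ∈ A <;> simp [signReorient, h]

theorem signReorient_neg (A : Set α) (X : α → SignType) :
    signReorient A (-X) = -signReorient A X := by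
  funext e; by_cases h : e ∈ A <;> simp [signReorient, h]

theorem support_signReorient (A : Set α) (X : α → SignType) :
    Function.support (signReorient A X) = Function.support X := by
  ext e
  by_cases h : e ∈ A
  · simp only [Function.mem_support, signReorient, h, if_true]
    cases X e <;> decide
  · simp [signReorient, h]

theorem signReorient_mul (A : Set α) (X Y : α → SignType) (e : α) :
    signReorient A X e * signReorient A Y e = X e * Y e := by
  by_cases h : e ∈ A
  · simp only [signReorient, h, if_true]
    cases X e <;> cases Y e <;> decide
  · simp [signReorient, h]

theorem _root_.IsSignature.signReorient {S : Set (α → SignType)} {P : Set α → Prop}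
    (h : IsSignature S P) (A : Set α) : IsSignature (signReorient A '' S) P where
  support_iff C := by
    rw [h.support_iff, Set.exists_mem_image]
    simp only [support_signReorient]
  neg_mem := by
    rintro _ ⟨X, hX, rfl⟩
    exact ⟨-X, h.neg_mem X hX, signReorient_neg A X⟩
  eq_or_eq_neg := by
    rintro _ ⟨X, hX, rfl⟩ _ ⟨Y, hY, rfl⟩ hs
    rw [support_signReorient, support_signReorient] at hs
    rcases h.eq_or_eq_neg X hX Y hY hs with rfl | rfl
    · exact Or.inl rfl
    · exact Or.inr (signReorient_neg A Y)

/-- The reorientation of `M` on `A`. -/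
noncomputable def reorient (M : OrientedMatroid α) (A : Set α) : OrientedMatroid α where
  toMatroid := M.toMatroid
  circuits := signReorient A '' M.circuits
  cocircuits := signReorient A '' M.cocircuits
  ground_finite := M.ground_finite
  circuits_sig := M.circuits_sig.signReorient A
  cocircuits_sig := M.cocircuits_sig.signReorient A
  orthogonal := by
    rintro _ ⟨X, hX, rfl⟩ _ ⟨Y, hY, rfl⟩
    simp only [SignedOrthogonal, signReorient_mul]
    exact M.orthogonal X hX Y hY

/-- The signed set `X` with the element `e` removed. -/
noncomputable def _root_.signErase (e : α) (X : α → SignType) : α → SignType :=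
  open Classical in fun x => if x = e then 0 else X x

theorem support_signErase (e : α) (X : α → SignType) :
    Function.support (signErase e X) = Function.support X \ {e} := by
  ext x; by_cases h : x = e <;> simp [signErase, h]

theorem signErase_neg (e : α) (X : α → SignType) : signErase e (-X) = -signErase e X := by
  funext x; by_cases h : x = e <;> simp [signErase, h]

open Matroid in
/-- The deletion of an element: the signed circuits are those avoiding `e`; the signed cocircuits
are the restrictions of signed cocircuits of `M` whose support is a cocircuit of the deletion,
that is, the restrictions that are nonempty and minimal. -/
noncomputable def delete (M : OrientedMatroid α) (e : α) : OrientedMatroid α where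
  toMatroid := M.toMatroid ＼ {e}
  circuits := {X | X ∈ M.circuits ∧ X e = 0}
  cocircuits := {Y | (∃ Z ∈ M.cocircuits, Y = signErase e Z) ∧
    (M.toMatroid ＼ {e}).IsCocircuit (Function.support Y)}
  ground_finite := M.ground_finite.subset Set.sdiff_subset
  circuits_sig := by
    constructor
    · intro C
      rw [Matroid.delete_isCircuit_iff, M.circuits_sig.support_iff]
      constructor
      · rintro ⟨⟨X, hX, rfl⟩, hd⟩
        exact ⟨X, ⟨hX, by simpa using hd⟩, rfl⟩
      · rintro ⟨X, ⟨hX, he⟩, rfl⟩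
        exact ⟨⟨X, hX, rfl⟩, by simpa using he⟩
    · rintro X ⟨hX, he⟩
      exact ⟨M.circuits_sig.neg_mem X hX, by simp [he]⟩
    · rintro X ⟨hX, -⟩ Y ⟨hY, -⟩ h
      exact M.circuits_sig.eq_or_eq_neg X hX Y hY h
  cocircuits_sig := by
    constructor
    · intro K
      constructor
      · intro hK
        have hK' : (M.toMatroid✶ ／ {e}).IsCircuit K := by
          rw [← Matroid.dual_delete]; exact hK
        obtain ⟨C', hC', hKC, hCK⟩ := hK'.exists_subset_isCircuit_of_contract
        obtain ⟨Z, hZ, rfl⟩ := (M.cocircuits_sig.support_iff C').1 hC'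
        have heK : e ∉ K := fun h => (hK'.subset_ground h).2 rfl
        have hs : Function.support (signErase e Z) = K := by
          rw [support_signErase]
          ext x
          constructor
          · rintro ⟨hx, hxe⟩
            rcases hCK hx with h | h
            · exact h
            · exact absurd h hxe
          · intro hx
            exact ⟨hKC hx, fun h => heK (h ▸ hx)⟩
        exact ⟨signErase e Z, ⟨⟨Z, hZ, rfl⟩, hs.symm ▸ hK⟩, hs⟩
      · rintro ⟨Y, ⟨-, hY⟩, rfl⟩
        exact hY
    · rintro _ ⟨⟨Z, hZ, rfl⟩, hK⟩
      refine ⟨⟨-Z, M.cocircuits_sig.neg_mem Z hZ, (signErase_neg e Z).symm⟩, ?_⟩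
      have hs : Function.support (-signErase e Z) = Function.support (signErase e Z) := by
        ext x
        simp only [Function.mem_support, Pi.neg_apply]
        cases signErase e Z x <;> decide
      rw [hs]; exact hK
    · rintro _ ⟨⟨Z, hZ, rfl⟩, hK⟩ _ ⟨⟨Z', hZ', rfl⟩, -⟩ hs
      obtain ⟨a, ha⟩ := hK.nonempty
      have key : ∀ b ∈ Function.support (signErase e Z),
          signErase e Z a * signErase e Z' a = signErase e Z b * signErase e Z' b := by
        intro b hb
        by_cases hab : a = b
        · rw [hab]
        obtain ⟨D, hD, hDK⟩ := Matroid.exists_isCocircuit_inter_eq_pair hK.isCircuit ha hb hab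
        rw [Matroid.dual_isCocircuit_iff, Matroid.delete_isCircuit_iff,
          M.circuits_sig.support_iff] at hD
        obtain ⟨⟨X, hX, rfl⟩, hd⟩ := hD
        have hXe : X e = 0 := by simpa using hd
        have aux : ∀ W : α → SignType,
            Function.support W \ {e} = Function.support (signErase e Z) →
            Function.support X ∩ Function.support W = {a, b} := by
          intro W hW
          rw [← hDK, ← hW]
          ext x
          constructor
          · rintro ⟨h1, h2⟩
            exact ⟨h1, h2, fun h => h1 (by rw [Set.mem_singleton_iff.1 h]; exact hXe)⟩
          · rintro ⟨h1, h2, -⟩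
            exact ⟨h1, h2⟩
        have h1 := (M.orthogonal X hX Z hZ).mul_eq_neg (aux Z (support_signErase e Z).symm)
        have h2 := (M.orthogonal X hX Z' hZ').mul_eq_neg
          (aux Z' (by rw [hs, support_signErase]))
        have hae : a ≠ e := fun h => ha (by simp [signErase, h])
        have hbe : b ≠ e := fun h => hb (by simp [signErase, h])
        have hXa : X a ≠ 0 := by
          have : a ∈ Function.support X ∩ Function.support Z := by
            rw [aux Z (support_signErase e Z).symm]; exact Or.inl rfl
          exact this.1
        have hXb : X b ≠ 0 := by
          have : b ∈ Function.support X ∩ Function.support Z := by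
            rw [aux Z (support_signErase e Z).symm]; exact Or.inr rfl
          exact this.1
        simp only [signErase, hae, hbe, if_false]
        revert h1 h2 hXa hXb
        generalize X a = p
        generalize X b = q
        generalize Z a = r
        generalize Z b = s
        generalize Z' a = t
        generalize Z' b = u
        revert p q r s t u
        decide
      have hs0 : ∀ x, signErase e Z x = 0 ↔ signErase e Z' x = 0 := by
        intro x
        have := Set.ext_iff.1 hs x
        simp only [Function.mem_support] at this
        tauto
      have ha' : signErase e Z a ≠ 0 := ha
      have ha0 := hs0 a
      by_cases hsgn : signErase e Z a = signErase e Z' a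
      · left
        funext x
        by_cases hx : signErase e Z x = 0
        · rw [hx, (hs0 x).1 hx]
        · have hk := key x hx
          have hx0 := hs0 x
          revert hk hx0 hx hsgn ha' ha0
          generalize signErase e Z a = p
          generalize signErase e Z' a = q
          generalize signErase e Z x = r
          generalize signErase e Z' x = s
          revert p q r s
          decide
      · right
        funext x
        rw [Pi.neg_apply]
        by_cases hx : signErase e Z x = 0
        · rw [hx, (hs0 x).1 hx]; decide
        · have hk := key x hx
          have hx0 := hs0 x
          revert hk hx0 hx hsgn ha' ha0
          generalize signErase e Z a = p
          generalize signErase e Z' a = q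
          generalize signErase e Z x = r
          generalize signErase e Z' x = s
          revert p q r s
          decide
  orthogonal := by
    rintro X ⟨hX, he⟩ _ ⟨⟨Z, hZ, rfl⟩, -⟩
    have h : ∀ x, X x * signErase e Z x = X x * Z x := by
      intro x
      by_cases hx : x = e
      · subst hx; simp [he]
      · simp [signErase, hx]
    simp only [SignedOrthogonal, h]
    exact M.orthogonal X hX Z hZ

/-- The contraction of an element, dual to the deletion. -/
noncomputable def contract (M : OrientedMatroid α) (e : α) : OrientedMatroid α :=
  (M.dual.delete e).dual

/-- `M` is acyclic: there is no positive circuit. -/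
def Acyclic (M : OrientedMatroid α) : Prop :=
  ¬ ∃ X ∈ M.circuits, ∀ x, 0 ≤ X x

/-- `M` is totally cyclic: every element belongs to a positive circuit. -/
def TotallyCyclic (M : OrientedMatroid α) : Prop :=
  ∀ e ∈ M.toMatroid.E, ∃ X ∈ M.circuits, (∀ x, 0 ≤ X x) ∧ X e ≠ 0

/-- `X` is the signed circuit with support contained in `B ∪ {e}` and positive at `e`. -/
def IsFundCircuit (M : OrientedMatroid α) (B : Set α) (e : α) (X : α → SignType) : Prop :=
  X ∈ M.circuits ∧ Function.support X ⊆ insert e B ∧ X e = 1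

/-- `Y` is the signed cocircuit whose support is the complement of the closure of `B \ {b}`,
and positive at `b`. -/
def IsFundCocircuit (M : OrientedMatroid α) (B : Set α) (b : α) (Y : α → SignType) : Prop :=
  Y ∈ M.cocircuits ∧
    Function.support Y = M.toMatroid.E \ M.toMatroid.closure (B \ {b}) ∧ Y b = 1

theorem existsUnique_isFundCircuit (M : OrientedMatroid α) {B : Set α} {e : α}
    (hB : M.toMatroid.IsBase B) (he : e ∈ M.toMatroid.E \ B) : ∃! X, M.IsFundCircuit B e X := by
  have hC := hB.fundCircuit_isCircuit he.1 he.2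
  have huniq : ∀ X ∈ M.circuits, Function.support X ⊆ insert e B →
      Function.support X = M.toMatroid.fundCircuit e B := fun X hX hs =>
    Matroid.IsCircuit.eq_fundCircuit_of_subset ((M.circuits_sig.support_iff _).2 ⟨X, hX, rfl⟩)
      hB.indep hs
  obtain ⟨X, hX, hXs⟩ := (M.circuits_sig.support_iff _).1 hC
  have hXi : Function.support X ⊆ insert e B := by
    rw [hXs]; exact M.toMatroid.fundCircuit_subset_insert e B
  have hXe : X e ≠ 0 := by
    have : e ∈ Function.support X := by rw [hXs]; exact M.toMatroid.mem_fundCircuit e B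
    exact this
  have hneg : Function.support (-X) = Function.support X := by
    ext x
    simp only [Function.mem_support, Pi.neg_apply]
    cases X x <;> decide
  have hex : ∃ X, M.IsFundCircuit B e X := by
    by_cases h1 : X e = 1
    · exact ⟨X, hX, hXi, h1⟩
    · refine ⟨-X, M.circuits_sig.neg_mem X hX, hneg ▸ hXi, ?_⟩
      rw [Pi.neg_apply]
      revert h1 hXe
      generalize X e = p
      revert p
      decide
  obtain ⟨Y, hY, hYi, hYe⟩ := hex
  refine ⟨Y, ⟨hY, hYi, hYe⟩, ?_⟩
  rintro Z ⟨hZ, hZi, hZe⟩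
  rcases M.circuits_sig.eq_or_eq_neg Z hZ Y hY
    ((huniq Z hZ hZi).trans (huniq Y hY hYi).symm) with h | h
  · exact h
  · rw [h, Pi.neg_apply, hYe] at hZe
    exact absurd hZe (by decide)

theorem _root_.Matroid.IsBase.fundCocircuit_eq_compl_closure {M : Matroid α} {B : Set α}
    (hB : M.IsBase B) {b : α} (hb : b ∈ B) :
    M.fundCocircuit b B = M.E \ M.closure (B \ {b}) := by
  have hcl : ∀ x ∈ M.E, x ∉ B → x ∈ M.closure B := fun x hx _ => by
    rw [hB.closure_eq]; exact hx
  have hbcl : b ∉ M.closure (B \ {b}) := hB.indep.notMem_closure_sdiff_of_mem hb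
  have hBE := hB.subset_ground
  ext x
  constructor
  · intro hx
    have hxE : x ∈ M.E := (Matroid.fundCocircuit_isCocircuit hb hB).subset_ground hx
    refine ⟨hxE, fun hxc => ?_⟩
    by_cases hxb : x = b
    · exact hbcl (hxb ▸ hxc)
    have hxB : x ∉ B := by
      rcases M.fundCocircuit_subset_insert_compl b B hx with h | h
      · exact absurd h hxb
      · exact h.2
    have h1 := hB.mem_fundCocircuit_iff_mem_fundCircuit.1 hx
    rw [hB.indep.mem_fundCircuit_iff (hcl x hxE hxB) hxB] at h1
    have h2 : insert x B \ {b} = insert x (B \ {b}) := by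
      ext y
      simp only [Set.mem_sdiff, Set.mem_insert_iff, Set.mem_singleton_iff]
      constructor
      · rintro ⟨rfl | h, h'⟩
        · exact Or.inl rfl
        · exact Or.inr ⟨h, h'⟩
      · rintro (rfl | ⟨h, h'⟩)
        · exact ⟨Or.inl rfl, hxb⟩
        · exact ⟨Or.inr h, h'⟩
    rw [h2, Matroid.Indep.insert_indep_iff (hB.indep.subset Set.sdiff_subset)] at h1
    rcases h1 with h1 | h1
    · exact h1.2 hxc
    · exact hxB h1.1
  · rintro ⟨hxE, hxc⟩
    by_cases hxb : x = b
    · rw [hxb]; exact M.mem_fundCocircuit b B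
    have hxB : x ∉ B := fun h =>
      hxc (M.subset_closure (B \ {b}) (Set.sdiff_subset.trans hBE) ⟨h, hxb⟩)
    refine hB.mem_fundCocircuit_iff_mem_fundCircuit.2 ?_
    rw [hB.indep.mem_fundCircuit_iff (hcl x hxE hxB) hxB]
    have h2 : insert x B \ {b} = insert x (B \ {b}) := by
      ext y
      simp only [Set.mem_sdiff, Set.mem_insert_iff, Set.mem_singleton_iff]
      constructor
      · rintro ⟨rfl | h, h'⟩
        · exact Or.inl rfl
        · exact Or.inr ⟨h, h'⟩
      · rintro (rfl | ⟨h, h'⟩)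
        · exact ⟨Or.inl rfl, hxb⟩
        · exact ⟨Or.inr h, h'⟩
    rw [h2, Matroid.Indep.insert_indep_iff (hB.indep.subset Set.sdiff_subset)]
    exact Or.inl ⟨hxE, hxc⟩

theorem existsUnique_isFundCocircuit (M : OrientedMatroid α) {B : Set α} {b : α}
    (hB : M.toMatroid.IsBase B) (hb : b ∈ B) : ∃! Y, M.IsFundCocircuit B b Y := by
  have hK := Matroid.fundCocircuit_isCocircuit hb hB
  rw [hB.fundCocircuit_eq_compl_closure hb] at hK
  obtain ⟨X, hX, hXs⟩ := (M.cocircuits_sig.support_iff _).1 hK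
  have hXe : X b ≠ 0 := by
    have : b ∈ Function.support X := by
      rw [hXs]
      exact ⟨hB.subset_ground hb, hB.indep.notMem_closure_sdiff_of_mem hb⟩
    exact this
  have hneg : Function.support (-X) = Function.support X := by
    ext x
    simp only [Function.mem_support, Pi.neg_apply]
    cases X x <;> decide
  have hex : ∃ X, M.IsFundCocircuit B b X := by
    by_cases h1 : X b = 1
    · exact ⟨X, hX, hXs, h1⟩
    · refine ⟨-X, M.cocircuits_sig.neg_mem X hX, hneg.trans hXs, ?_⟩
      rw [Pi.neg_apply]
      revert h1 hXe
      generalize X b = p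
      revert p
      decide
  obtain ⟨Y, hY, hYs, hYb⟩ := hex
  refine ⟨Y, ⟨hY, hYs, hYb⟩, ?_⟩
  rintro Z ⟨hZ, hZs, hZb⟩
  rcases M.cocircuits_sig.eq_or_eq_neg Z hZ Y hY (hZs.trans hYs.symm) with h | h
  · exact h
  · rw [h, Pi.neg_apply, hYb] at hZb
    exact absurd hZb (by decide)

open Classical in
/-- The fundamental circuit `C(B; e)` of a basis `B` with respect to an element `e` of the ground
set not in `B` (and the empty signed set if these conditions fail). -/
noncomputable def fundCircuit (M : OrientedMatroid α) (B : Set α) (e : α) : α → SignType :=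
  if h : M.toMatroid.IsBase B ∧ e ∈ M.toMatroid.E \ B then
    (M.existsUnique_isFundCircuit h.1 h.2).choose else 0

open Classical in
/-- The fundamental cocircuit `C*(B; b)` of a basis `B` with respect to `b ∈ B`
(and the empty signed set if these conditions fail). -/
noncomputable def fundCocircuit (M : OrientedMatroid α) (B : Set α) (b : α) : α → SignType :=
  if h : M.toMatroid.IsBase B ∧ b ∈ B then
    (M.existsUnique_isFundCocircuit h.1 h.2).choose else 0

theorem fundCircuit_spec (M : OrientedMatroid α) {B : Set α} {e : α}
    (hB : M.toMatroid.IsBase B) (he : e ∈ M.toMatroid.E \ B) :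
    M.IsFundCircuit B e (M.fundCircuit B e) := by
  have h : M.toMatroid.IsBase B ∧ e ∈ M.toMatroid.E \ B := ⟨hB, he⟩
  rw [fundCircuit, dif_pos h]
  exact (M.existsUnique_isFundCircuit h.1 h.2).choose_spec.1

theorem fundCocircuit_spec (M : OrientedMatroid α) {B : Set α} {b : α}
    (hB : M.toMatroid.IsBase B) (hb : b ∈ B) :
    M.IsFundCocircuit B b (M.fundCocircuit B b) := by
  have h : M.toMatroid.IsBase B ∧ b ∈ B := ⟨hB, hb⟩
  rw [fundCocircuit, dif_pos h]
  exact (M.existsUnique_isFundCocircuit h.1 h.2).choose_spec.1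

/-- `N` is a generic extension of `M` with respect to `f`: deleting the element `f` of `N` gives
`M`, and the circuits of `N` containing `f` are exactly the sets `B ∪ {f}`, `B` a basis of `M`. -/
def IsGenericExtension (M N : OrientedMatroid α) (f : α) : Prop :=
  f ∈ N.toMatroid.E ∧ N.delete f = M ∧
    ∀ C : Set α, (N.toMatroid.IsCircuit C ∧ f ∈ C) ↔
      ∃ B, M.toMatroid.IsBase B ∧ C = insert f B

/-- `N` is a generic lifting of `M` with respect to `g`: contracting the element `g` of `N` gives
`M`, and the cocircuits of `N` containing `g` are exactly the sets `(E \ B) ∪ {g}`, where `B` is a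
basis of `M` and `E` is the ground set of `M`. -/
def IsGenericLifting (M N : OrientedMatroid α) (g : α) : Prop :=
  g ∈ N.toMatroid.E ∧ N.contract g = M ∧
    ∀ D : Set α, (N.toMatroid.IsCocircuit D ∧ g ∈ D) ↔
      ∃ B, M.toMatroid.IsBase B ∧ D = insert g (M.toMatroid.E \ B)

/-- `N` is a generic extension-lifting of `M` with respect to `(f, g)`. -/
def IsGenericExtensionLifting (M N : OrientedMatroid α) (f g : α) : Prop :=
  f ≠ g ∧ (N.contract g).delete f = M ∧
    IsGenericExtension (N.delete f) N f ∧ IsGenericLifting (N.contract g) N g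

/-- No vertex of `N` lies on the positive side of `g` and on the negative side of `f`. -/
def IsCompliant (N : OrientedMatroid α) (f g : α) : Prop :=
  ¬ ∃ Y ∈ N.cocircuits, Y g = 1 ∧ Y f = -1

/-- The sets `A` such that the reorientation of `N` on `A` is a bounded region of `N` with respect
to `(f, g)`. -/
def boundedRegions (N : OrientedMatroid α) (f g : α) : Set (Set α) :=
  {A | A ⊆ N.toMatroid.E ∧ f ∉ A ∧ g ∉ A ∧
    ((N.reorient A).delete f).Acyclic ∧ ((N.reorient A).contract g).TotallyCyclic}

/-- The bases of `N` containing `g` but not `f`. -/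
def basesWithWithout (N : OrientedMatroid α) (f g : α) : Set (Set α) :=
  {B | N.toMatroid.IsBase B ∧ g ∈ B ∧ f ∉ B}

/-- For a basis `B` of `N`: the signed sets `C*(B; g) \ f` and `C(B; f) \ g` of `N` become positive
when they are reoriented on `A`. -/
def PositiveIn (N : OrientedMatroid α) (f g : α) (A B : Set α) : Prop :=
  (∀ x, 0 ≤ signReorient A (signErase f (N.fundCocircuit B g)) x) ∧
    (∀ x, 0 ≤ signReorient A (signErase g (N.fundCircuit B f)) x)

/-- `B` is an optimal basis of the oriented matroid program `(P, g, f)` with element at infinity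
`g` and objective function `f`. -/
def IsOptimalBasis (P : OrientedMatroid α) (g f : α) (B : Set α) : Prop :=
  P.toMatroid.IsBase B ∧ g ∈ B ∧ f ∉ B ∧
    (∀ x, x ≠ f → 0 ≤ P.fundCocircuit B g x) ∧ (∀ x, x ≠ g → 0 ≤ P.fundCircuit B f x)

/-- The sign of `X` at `e` is opposite to its sign at the smallest element of its support. -/
def OppositeToMin [LinearOrder α] (X : α → SignType) (e : α) : Prop :=
  ∃ m, IsLeast (Function.support X) m ∧ X m = -X e

/-- `B` is a fully optimal basis of the ordered oriented matroid `P`: for `e ∉ B`, the signs of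
`e` and of the smallest element in `C(B; e)` are opposite, and for `b ∈ B` other than the smallest
element of the ground set, the signs of `b` and of the smallest element in `C*(B; b)` are
opposite. -/
def IsFullyOptimalBasis [LinearOrder α] (P : OrientedMatroid α) (B : Set α) : Prop :=
  P.toMatroid.IsBase B ∧
    (∀ e ∈ P.toMatroid.E \ B, OppositeToMin (P.fundCircuit B e) e) ∧
    (∀ b ∈ B, ¬ IsLeast P.toMatroid.E b → OppositeToMin (P.fundCocircuit B b) b)

/-- `P` is bounded with respect to `p`: it is a region (it is acyclic), none of whose vertices
belongs to `p`. -/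
def IsBoundedAt (P : OrientedMatroid α) (p : α) : Prop :=
  P.Acyclic ∧ ∀ Y ∈ P.cocircuits, (∀ x, 0 ≤ Y x) → Y p ≠ 0

/-- The graph of the active bijection in the bounded case, for an ordered oriented matroid `N`
with smallest element `p`: it sends each reorientation of `N` that is bounded with respect to `p`
(with the orientation of `p` kept fixed) to its fully optimal basis. -/
def activeBijection [LinearOrder α] (N : OrientedMatroid α) : Set (Set α × Set α) :=
  {q | q.1 ⊆ N.toMatroid.E ∧
    (∃ p, IsLeast N.toMatroid.E p ∧ p ∉ q.1 ∧ (N.reorient q.1).IsBoundedAt p) ∧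
    (N.reorient q.1).IsFullyOptimalBasis q.2}

end OrientedMatroid

/-! Write N for the extension-lifting and E for its ground set. Genericity says that f is free in N
and g is free in the dual (`IsGenericPair`), a condition that is its own dual. For a basis B with g
in B and f not in B it forces full supports: C(B;f) is supported on B ∪ f and C*(B;g) on E \ (B \
g). Every element other than f and g therefore lies in exactly one of the two supports, so
positivity of C*(B;g) \ f and C(B;f) \ g prescribes, element by element, whether to reorient
(`positiveIn_iff`). This gives the map from bases to reorientations. The resulting region is bounded
because a positive circuit avoiding f, or a positive cocircuit avoiding g, would violate
orthogonality with one of these two signed sets.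

The map from regions to bases is oriented matroid programming. By Minty's painting lemma
(`exists_circuit_or_cocircuit`), acyclicity of N \ f yields a cocircuit positive at g and
nonnegative off f; total cyclicity of N / g yields dually a circuit positive at f and nonnegative
off g. Strong duality (`exists_optimal_of_feasible`) turns this feasible pair into an optimal basis,
by induction on the number of sign constraints. Uniqueness (`isBase_eq_of_mul_nonneg`) comes from
eliminating g between the two cocircuits C*(B;g): the result would have to be both positive and
negative at f.

For an ordering g < f < E, the identity C*(B;b)(e) = -C(B;e)(b) reads full optimality off the row of
f and the column of g: it is optimality together with C*(B;g) being positive at f. Compliance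
supplies exactly this last sign, and also identifies the domains of the two bijections.

Finally, C*(B;g) off f depends only on N \ f, and C(B;f) off g only on N / g, so the bijection does
not see the rest of N. A compliant replacement is built by placing f infinitely close to g: in a
circuit through f, the new f imitates g and the old f breaks ties (`pushCircuit`). Supports do not
change, cocircuits are modified dually, and the content is that orthogonality survives
(`signedOrthogonal_pushCircuit`). -/

theorem SignedOrthogonal.symm {α : Type*} {X Y : α → SignType} (h : SignedOrthogonal X Y) :
    SignedOrthogonal Y X := by
  simpa only [SignedOrthogonal, mul_comm (Y _)] using h

/-- Orthogonal signed sets cannot agree on their whole common support. -/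
theorem SignedOrthogonal.false_of_nonneg {α : Type*} {X Y : α → SignType}
    (h : SignedOrthogonal X Y) (e : α) (he : X e * Y e ≠ 0) (hp : ∀ x, 0 ≤ X x * Y x) :
    False := by
  obtain ⟨-, q, hq⟩ := h ⟨e, he⟩
  have := hp q
  rw [hq] at this
  exact absurd this (by decide)

theorem SignedOrthogonal.exists_eq_neg_one {α : Type*} {X Y : α → SignType}
    (h : SignedOrthogonal X Y) {e : α} (he : X e * Y e = 1) : ∃ x, X x * Y x = -1 :=
  (h ⟨e, by rw [he]; decide⟩).2

theorem SignType.mul_nonneg_of {a b : SignType} (ha : 0 ≤ a) (hb : 0 ≤ b) : 0 ≤ a * b := by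
  revert a b; decide

theorem SignType.mul_nonneg_of_mul {s a b : SignType} (hs : s ≠ 0) (ha : 0 ≤ s * a)
    (hb : 0 ≤ s * b) : 0 ≤ a * b := by
  revert s a b; decide

theorem Function.support_neg_signType {α : Type*} (X : α → SignType) :
    Function.support (-X) = Function.support X := by
  ext x
  simp only [Function.mem_support, Pi.neg_apply]
  cases X x <;> decide

/-! ### Minty's painting lemma and signed elimination. -/

namespace OrientedMatroid

variable {α : Type*}

theorem isCircuit_support (N : OrientedMatroid α) {X : α → SignType} (hX : X ∈ N.circuits) :
    N.toMatroid.IsCircuit (Function.support X) :=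
  (N.circuits_sig.support_iff _).2 ⟨X, hX, rfl⟩

theorem isCocircuit_support (N : OrientedMatroid α) {Y : α → SignType} (hY : Y ∈ N.cocircuits) :
    N.toMatroid.IsCocircuit (Function.support Y) :=
  (N.cocircuits_sig.support_iff _).2 ⟨Y, hY, rfl⟩

theorem circuit_eq_zero (N : OrientedMatroid α) {X : α → SignType} (hX : X ∈ N.circuits)
    {x : α} (hx : x ∉ N.toMatroid.E) : X x = 0 := by
  by_contra h
  exact hx ((N.isCircuit_support hX).subset_ground h)

theorem cocircuit_eq_zero (N : OrientedMatroid α) {Y : α → SignType} (hY : Y ∈ N.cocircuits)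
    {x : α} (hx : x ∉ N.toMatroid.E) : Y x = 0 :=
  N.dual.circuit_eq_zero hY hx

theorem exists_circuit_eq (N : OrientedMatroid α) {C : Set α} (hC : N.toMatroid.IsCircuit C)
    {e : α} (he : e ∈ C) {t : SignType} (ht : t ≠ 0) :
    ∃ X ∈ N.circuits, Function.support X = C ∧ X e = t := by
  obtain ⟨X, hX, rfl⟩ := (N.circuits_sig.support_iff C).1 hC
  have he' : X e ≠ 0 := he
  by_cases h : X e = t
  · exact ⟨X, hX, rfl, h⟩
  · refine ⟨-X, N.circuits_sig.neg_mem X hX, Function.support_neg_signType X, ?_⟩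
    rw [Pi.neg_apply]
    revert he' h ht
    generalize X e = a
    revert a t
    decide

/-- Extend a basis of S together with e to a basis B. The fundamental cocircuit of e avoids the
closure of B \ e, which contains S. -/
theorem _root_.Matroid.exists_isCocircuit_of_notMem_closure {M : Matroid α} {S : Set α} {e : α}
    (hS : S ⊆ M.E) (he : e ∈ M.E) (h : e ∉ M.closure S) :
    ∃ K, M.IsCocircuit K ∧ e ∈ K ∧ Disjoint K S := by
  obtain ⟨I, hI⟩ := M.exists_isBasis S hS
  have heI : e ∉ M.closure I := by rwa [hI.closure_eq_closure]
  have hins : M.Indep (insert e I) := (hI.indep.insert_indep_iff).2 (Or.inl ⟨he, heI⟩)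
  obtain ⟨B, hB, hIB⟩ := hins.exists_isBase_superset
  have heB : e ∈ B := hIB (Set.mem_insert _ _)
  refine ⟨M.fundCocircuit e B, Matroid.fundCocircuit_isCocircuit heB hB,
    M.mem_fundCocircuit e B, ?_⟩
  rw [hB.fundCocircuit_eq_compl_closure heB, Set.disjoint_left]
  rintro x ⟨-, hx⟩ hxS
  refine hx (M.closure_subset_closure ?_ (hI.subset_closure hxS))
  intro y hy
  refine ⟨hIB (Set.mem_insert_of_mem _ hy), ?_⟩
  rintro rfl
  exact heI (M.subset_closure I hI.indep.subset_ground hy)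

/-- Minty's painting lemma for oriented matroids. The elements of `P` carry prescribed signs `s`,
the elements of `D` are deleted and all elements outside `P ∪ D ∪ {e}` are contracted. -/
theorem exists_circuit_or_cocircuit (N : OrientedMatroid α) {e : α} (he : e ∈ N.toMatroid.E)
    (s : α → SignType) (hse : s e ≠ 0) {P : Set α} (hP : P.Finite) (D : Set α)
    (hsP : ∀ x ∈ P, s x ≠ 0) (heP : e ∉ P) (heD : e ∉ D) (hPD : ∀ x ∈ P, x ∉ D) :
    (∃ X ∈ N.circuits, X e = s e ∧ (∀ x ∈ P, 0 ≤ s x * X x) ∧ ∀ x ∈ D, X x = 0) ∨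
    (∃ Y ∈ N.cocircuits, Y e = s e ∧ (∀ x ∈ P, 0 ≤ s x * Y x) ∧
      ∀ x, x ∉ P → x ∉ D → x ≠ e → Y x = 0) := by
  induction P, hP using Set.Finite.induction_on generalizing D with
  | empty =>
    by_cases h : e ∈ N.toMatroid.closure (N.toMatroid.E \ insert e D)
    · left
      obtain ⟨C, hCs, hC, heC⟩ := Matroid.exists_isCircuit_of_mem_closure h
        (fun h => h.2 (Set.mem_insert _ _))
      obtain ⟨X, hX, rfl, hXe⟩ := N.exists_circuit_eq hC heC hse
      refine ⟨X, hX, hXe, fun x hx => hx.elim, fun x hx => ?_⟩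
      by_contra hne
      rcases hCs hne with rfl | h'
      · exact heD hx
      · exact h'.2 (Set.mem_insert_of_mem _ hx)
    · right
      obtain ⟨K, hK, heK, hdisj⟩ := Matroid.exists_isCocircuit_of_notMem_closure
        Set.sdiff_subset he h
      obtain ⟨Y, hY, rfl, hYe⟩ := N.dual.exists_circuit_eq hK heK hse
      refine ⟨Y, hY, hYe, fun x hx => hx.elim, fun x _ hxD hxe => ?_⟩
      by_contra hne
      refine Set.disjoint_left.1 hdisj hne ⟨?_, ?_⟩
      · exact hK.subset_ground hne
      · rintro (h | h)
        · exact hxe h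
        · exact hxD h
  | @insert x P hxP _ ih =>
    have hsP' : ∀ y ∈ P, s y ≠ 0 := fun y hy => hsP y (Or.inr hy)
    have heP' : e ∉ P := fun h => heP (Or.inr h)
    have hxe : e ≠ x := fun h => heP (Or.inl h)
    -- With x deleted, a circuit already settles the claim, since it vanishes at x. What remains is
    -- a cocircuit Y whose sign at x is uncontrolled.
    rcases ih (insert x D) hsP' heP'
      (by rintro (h | h); exacts [hxe h, heD h])
      (by
        rintro y hy (rfl | h)
        · exact hxP hy
        · exact hPD y (Or.inr hy) h) with ⟨X, hX, hXe, hXP, hXD⟩ | ⟨Y, hY, hYe, hYP, hYK⟩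
    · left
      refine ⟨X, hX, hXe, ?_, fun y hy => hXD y (Or.inr hy)⟩
      rintro y (rfl | hy)
      · rw [hXD y (Or.inl rfl), mul_zero]
      · exact hXP y hy
    -- With x contracted, a cocircuit settles the claim, and what remains is a circuit X whose sign
    -- at x is uncontrolled.
    rcases ih D hsP' heP' heD (fun y hy => hPD y (Or.inr hy)) with
      ⟨X, hX, hXe, hXP, hXD⟩ | ⟨Z, hZ, hZe, hZP, hZK⟩
    rotate_left
    · right
      refine ⟨Z, hZ, hZe, ?_, fun y hy => hZK y (fun h => hy (Or.inr h))⟩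
      rintro y (rfl | hy)
      · rw [hZK y hxP (hPD y (Or.inl rfl)) hxe.symm, mul_zero]
      · exact hZP y hy
    by_cases hXx : 0 ≤ s x * X x
    · left
      refine ⟨X, hX, hXe, ?_, hXD⟩
      rintro y (rfl | hy)
      · exact hXx
      · exact hXP y hy
    by_cases hYx : 0 ≤ s x * Y x
    · right
      refine ⟨Y, hY, hYe, ?_, fun y hy hyD hye => hYK y (fun h => hy (Or.inr h)) ?_ hye⟩
      · rintro y (rfl | hy)
        · exact hYx
        · exact hYP y hy
      · rintro (h | h)
        · exact hy (Or.inl h)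
        · exact hyD h
    -- X and Y both have the wrong sign at x, so they agree there; they also agree at e and never
    -- disagree elsewhere, against orthogonality.
    exfalso
    refine (N.orthogonal X hX Y hY).false_of_nonneg e ?_ ?_
    · rw [hXe, hYe]; exact mul_ne_zero hse hse
    · intro y
      by_cases h1 : y = e
      · subst h1; rw [hXe, hYe]; cases s y <;> decide
      by_cases h2 : y = x
      · subst h2
        revert hXx hYx
        generalize s y = a
        generalize X y = b
        generalize Y y = c
        revert a b c
        decide
      by_cases h3 : y ∈ P
      · exact SignType.mul_nonneg_of_mul (hsP' y h3) (hXP y h3) (hYP y h3)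
      by_cases h4 : y ∈ D
      · rw [hXD y h4, zero_mul]
      · rw [hYK y h3 (by rintro (h | h); exacts [h2 h, h4 h]) h1, mul_zero]

/-- Elimination of the element `g` between two signed circuits, keeping the element `e`. -/
theorem exists_circuit_elimination (N : OrientedMatroid α) {X₁ X₂ : α → SignType}
    (h₁ : X₁ ∈ N.circuits) (h₂ : X₂ ∈ N.circuits) {g e : α} (hg : X₁ g ≠ 0)
    (hgg : X₂ g = -X₁ g) (he : X₁ e ≠ 0) (hee : X₂ e ≠ -X₁ e) :
    ∃ Z ∈ N.circuits, Z g = 0 ∧ Z e = X₁ e ∧ ∀ x, Z x = 0 ∨ Z x = X₁ x ∨ Z x = X₂ x := by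
  classical
  have heg : e ≠ g := by rintro rfl; exact hee hgg
  -- The composition of X₁ with X₂, used as the prescribed signs.
  let s : α → SignType := fun x => if X₁ x ≠ 0 then X₁ x else X₂ x
  have hs : ∀ x, s x = if X₁ x ≠ 0 then X₁ x else X₂ x := fun _ => rfl
  have hse : s e = X₁ e := by rw [hs, if_pos he]
  -- Constrained are the elements where the two circuits do not conflict. The conflicting elements
  -- other than g are neither in P nor in D: there a circuit may take any sign, while a cocircuit
  -- must vanish.
  let P : Set α := {x | s x ≠ 0 ∧ ¬ (X₁ x ≠ 0 ∧ X₂ x = -X₁ x) ∧ x ≠ e}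
  let D : Set α := {x | x = g ∨ s x = 0}
  have hPfin : P.Finite := by
    refine N.ground_finite.subset fun x hx => ?_
    by_contra hxE
    refine hx.1 ?_
    rw [hs, N.circuit_eq_zero h₁ hxE, N.circuit_eq_zero h₂ hxE]; simp
  rcases N.exists_circuit_or_cocircuit ((N.isCircuit_support h₁).subset_ground he) s
    (by rwa [hse]) hPfin D (fun x hx => hx.1) (fun h => h.2.2 rfl)
    (by rintro (h | h); exacts [heg h, he (hse ▸ h)])
    (by
      rintro x hx (rfl | h)
      · exact hx.2.1 ⟨hg, hgg⟩
      · exact hx.1 h) with ⟨Z, hZ, hZe, hZP, hZD⟩ | ⟨Y, hY, hYe, hYP, hYK⟩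
  · refine ⟨Z, hZ, hZD g (Or.inl rfl), hZe.trans hse, fun x => ?_⟩
    by_cases hxe : x = e
    · subst hxe; exact Or.inr (Or.inl (hZe.trans hse))
    by_cases hxD : x ∈ D
    · exact Or.inl (hZD x hxD)
    have hsx : s x ≠ 0 := fun h => hxD (Or.inr h)
    by_cases hc : X₁ x ≠ 0 ∧ X₂ x = -X₁ x
    · obtain ⟨hc1, hc2⟩ := hc
      rw [hc2]
      revert hc1
      generalize X₁ x = a
      generalize Z x = b
      revert a b
      decide
    · have := hZP x ⟨hsx, hc, hxe⟩
      rw [hs] at this hsx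
      revert this hsx
      generalize X₁ x = a
      generalize X₂ x = b
      generalize Z x = c
      revert a b c
      decide
  · exfalso
    have hYc : ∀ x, x ≠ g → x ≠ e → X₁ x ≠ 0 → X₂ x = -X₁ x → Y x = 0 := by
      intro x hxg hxe hc1 hc2
      refine hYK x (fun h => h.2.1 ⟨hc1, hc2⟩) ?_ hxe
      rintro (h | h)
      · exact hxg h
      · rw [hs, if_pos hc1] at h; exact hc1 h
    -- Off g the cocircuit Y never disagrees with X₁ or with X₂. Orthogonality with X₁ then needs a
    -- disagreement at g; since X₂ has the other sign there, X₂ and Y agree at g and never disagree,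
    -- which is impossible.
    have key : ∀ x, x ≠ g → 0 ≤ X₁ x * Y x ∧ 0 ≤ X₂ x * Y x := by
      intro x hxg
      by_cases hxe : x = e
      · subst hxe
        rw [hYe, hse]
        revert he hee
        generalize X₁ x = a
        generalize X₂ x = b
        revert a b
        decide
      by_cases hc : X₁ x ≠ 0 ∧ X₂ x = -X₁ x
      · rw [hYc x hxg hxe hc.1 hc.2]; simp
      by_cases hsx : s x = 0
      · rw [hs] at hsx
        revert hsx
        generalize X₁ x = a
        generalize X₂ x = b
        generalize Y x = c
        revert a b c
        decide
      have := hYP x ⟨hsx, hc, hxe⟩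
      rw [hs] at this hsx
      revert this hsx hc
      generalize X₁ x = a
      generalize X₂ x = b
      generalize Y x = c
      revert a b c
      decide
    obtain ⟨x, hx⟩ := (N.orthogonal X₁ h₁ Y hY).exists_eq_neg_one (e := e)
      (by rw [hYe, hse]; revert he; generalize X₁ e = a; revert a; decide)
    have hxg : x = g := by
      by_contra h
      have := (key x h).1
      rw [hx] at this
      exact absurd this (by decide)
    subst hxg
    obtain ⟨y, hy⟩ := (N.orthogonal X₂ h₂ Y hY).exists_eq_neg_one (e := x)
      (by
        rw [hgg]; revert hx
        generalize X₁ x = a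
        generalize Y x = b
        revert a b
        decide)
    by_cases hyx : y = x
    · subst hyx
      rw [hgg] at hy
      revert hx hy
      generalize X₁ y = a
      generalize Y y = b
      revert a b
      decide
    · have := (key y hyx).2
      rw [hy] at this
      exact absurd this (by decide)

end OrientedMatroid

/-! ### Free elements and generic pairs. -/

namespace Matroid

variable {α : Type*} {M : Matroid α} {e f g : α}

/-- The element `f` is free: it is not a coloop, and the circuits containing it are exactly the
sets `B ∪ {f}` for `B` a basis avoiding `f`. -/
structure IsFreeElement (M : Matroid α) (f : α) : Prop where
  coindep : M.Coindep {f}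
  isBase_sdiff : ∀ C, M.IsCircuit C → f ∈ C → M.IsBase (C \ {f})
  isCircuit_insert : ∀ B, M.IsBase B → f ∉ B → M.IsCircuit (insert f B)

theorem IsFreeElement.mem_ground (h : M.IsFreeElement f) : f ∈ M.E :=
  h.coindep.subset_ground rfl

theorem IsFreeElement.delete_isBase_iff (h : M.IsFreeElement f) {B : Set α} :
    (M.delete {f}).IsBase B ↔ M.IsBase B ∧ f ∉ B := by
  rw [h.coindep.delete_isBase_iff, Set.disjoint_singleton_right]

/-- The hypothesis speaks of bases of the deletion. The circuit formed by f with any one of them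
shows that f is not a coloop, and then these are the bases of the whole matroid that avoid f. -/
theorem isFreeElement_of_circuits (hf : f ∈ M.E)
    (h : ∀ C : Set α, (M.IsCircuit C ∧ f ∈ C) ↔
      ∃ B, (M.delete {f}).IsBase B ∧ C = insert f B) : M.IsFreeElement f := by
  obtain ⟨B₀, hB₀⟩ := (M.delete {f}).exists_isBase
  have hfB : ∀ B, (M.delete {f}).IsBase B → f ∉ B := fun B hB hfB => (hB.subset_ground hfB).2 rfl
  have hC₀ := ((h _).2 ⟨B₀, hB₀, rfl⟩).1
  have hcl : f ∈ M.closure (M.E \ {f}) := by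
    have h1 := hC₀.mem_closure_sdiff_singleton_of_mem (Set.mem_insert f B₀)
    refine M.closure_subset_closure ?_ h1
    rintro x ⟨hx, hxf⟩
    exact ⟨hC₀.subset_ground hx, hxf⟩
  have hco : M.Coindep {f} := by
    rw [coindep_iff_closure_compl_eq_ground (Set.singleton_subset_iff.2 hf)]
    refine (M.closure_subset_ground _).antisymm fun x hx => ?_
    by_cases hxf : x = f
    · exact hxf ▸ hcl
    · exact M.subset_closure (M.E \ {f}) Set.sdiff_subset ⟨hx, hxf⟩
  have hiff : ∀ B, (M.delete {f}).IsBase B ↔ M.IsBase B ∧ f ∉ B := fun B => by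
    rw [hco.delete_isBase_iff, Set.disjoint_singleton_right]
  refine ⟨hco, fun C hC hfC => ?_, fun B hB hfB => ((h _).2 ⟨B, (hiff B).2 ⟨hB, hfB⟩, rfl⟩).1⟩
  obtain ⟨B, hB, rfl⟩ := (h C).1 ⟨hC, hfC⟩
  have : insert f B \ {f} = B := by
    rw [Set.insert_sdiff_of_mem _ (Set.mem_singleton f),
      Set.sdiff_singleton_eq_self (hfB B hB)]
  rw [this]
  exact ((hiff B).1 hB).1

/-- `f` is free in `M` and `g` is free in the dual of `M`. -/
structure IsGenericPair (M : Matroid α) (f g : α) : Prop where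
  ne : f ≠ g
  free : M.IsFreeElement f
  dual_free : M.dual.IsFreeElement g

/-- Together with `OrientedMatroid.dual`, this lets statements about circuits through f be reused
for cocircuits through g. -/
theorem IsGenericPair.dual (h : M.IsGenericPair f g) : M.dual.IsGenericPair g f :=
  ⟨h.ne.symm, h.dual_free, by rw [Matroid.dual_dual]; exact h.free⟩

end Matroid

/-! ### Fundamental circuits and cocircuits of a generic pair. -/

namespace OrientedMatroid

variable {α : Type*} {M N : OrientedMatroid α} {f g : α} {B : Set α}

/-- Complementing bases translates the cocircuit condition for g in the contraction into the circuit
condition for g in the deletion of the dual. -/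
theorem IsGenericExtensionLifting.isGenericPair (h : M.IsGenericExtensionLifting N f g) :
    N.toMatroid.IsGenericPair f g := by
  obtain ⟨hne, -, ⟨hf, -, hext⟩, hg, -, hlift⟩ := h
  refine ⟨hne, Matroid.isFreeElement_of_circuits hf hext,
    Matroid.isFreeElement_of_circuits hg fun D => (hlift D).trans ?_⟩
  have hE : (N.contract g).toMatroid.E = N.toMatroid.E \ {g} := rfl
  have hd : (N.contract g).toMatroid = (N.toMatroid.dual.delete {g}).dual := rfl
  constructor
  · rintro ⟨B, hB, rfl⟩
    refine ⟨(N.contract g).toMatroid.E \ B, ?_, rfl⟩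
    rw [hd] at hB
    exact hB.compl_isBase_of_dual
  · rintro ⟨B, hB, rfl⟩
    refine ⟨(N.contract g).toMatroid.E \ B, ?_, ?_⟩
    · rw [hd]; exact hB.compl_isBase_dual
    · rw [Set.sdiff_sdiff_cancel_left]
      exact hB.subset_ground

theorem isGenericExtensionLifting_iff_of_eq {N' : OrientedMatroid α}
    (h : M.IsGenericExtensionLifting N f g) (hm : N'.toMatroid = N.toMatroid)
    (hd : N'.delete f = N.delete f) (hc : N'.contract g = N.contract g) :
    M.IsGenericExtensionLifting N' f g := by
  unfold IsGenericExtensionLifting IsGenericExtension IsGenericLifting at h ⊢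
  rw [hm, hd, hc]
  exact h

/-- The two supports can meet only in b and e. Orthogonality makes the products there opposite or
both zero, and the normalizations X e = 1 and Y b = 1 give the formula. -/
theorem isFundCircuit_apply_eq {b e : α} {X Y : α → SignType} (hbe : b ≠ e)
    (hX : N.IsFundCircuit B e X) (hY : N.IsFundCocircuit B b Y) (hBE : B ⊆ N.toMatroid.E) :
    Y e = -X b := by
  have hYB : ∀ x ∈ B, x ≠ b → Y x = 0 := by
    intro x hx hxb
    by_contra hne
    have : x ∈ Function.support Y := hne
    rw [hY.2.1] at this
    exact this.2 (N.toMatroid.subset_closure (B \ {b}) (Set.sdiff_subset.trans hBE) ⟨hx, hxb⟩)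
  have hz : ∀ x, x ≠ b → x ≠ e → X x * Y x = 0 := by
    intro x hxb hxe
    by_cases hx : X x = 0
    · rw [hx, zero_mul]
    · rcases hX.2.1 hx with h | h
      · exact absurd h hxe
      · rw [hYB x h hxb, mul_zero]
  have hcase : ∀ x, X x * Y x ≠ 0 → x = b ∨ x = e := by
    intro x hx
    by_contra hc
    rw [not_or] at hc
    exact hx (hz x hc.1 hc.2)
  have ho := N.orthogonal X hX.1 Y hY.1
  have hXe := hX.2.2
  have hYb := hY.2.2
  by_cases h0 : X b = 0 ∧ Y e = 0
  · rw [h0.1, h0.2]; decide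
  · have hmeet : ∃ x, X x * Y x ≠ 0 := by
      by_cases h1 : X b = 0
      · exact ⟨e, by rw [hXe, one_mul]; exact fun h => h0 ⟨h1, h⟩⟩
      · exact ⟨b, by rw [hYb, mul_one]; exact h1⟩
    obtain ⟨⟨p, hp⟩, q, hq⟩ := ho hmeet
    rcases hcase p (by rw [hp]; decide) with rfl | rfl <;>
      rcases hcase q (by rw [hq]; decide) with rfl | rfl
    · rw [hp] at hq; exact absurd hq (by decide)
    · rw [hYb, mul_one] at hp
      rw [hXe, one_mul] at hq
      rw [hp, hq]
    · rw [hXe, one_mul] at hp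
      rw [hYb, mul_one] at hq
      rw [hp, hq]; decide
    · rw [hp] at hq; exact absurd hq (by decide)

theorem fundCocircuit_eq_neg_fundCircuit {b e : α} (hB : N.toMatroid.IsBase B) (hb : b ∈ B)
    (he : e ∈ N.toMatroid.E \ B) : N.fundCocircuit B b e = -N.fundCircuit B e b :=
  isFundCircuit_apply_eq (by rintro rfl; exact he.2 hb) (N.fundCircuit_spec hB he)
    (N.fundCocircuit_spec hB hb) hB.subset_ground

theorem fundCircuit_eq_of_isFundCircuit (hB : N.toMatroid.IsBase B) {e : α}
    (he : e ∈ N.toMatroid.E \ B) {X : α → SignType} (hX : N.IsFundCircuit B e X) :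
    N.fundCircuit B e = X :=
  (N.existsUnique_isFundCircuit hB he).unique (N.fundCircuit_spec hB he) hX

theorem fundCocircuit_eq_of_isFundCocircuit (hB : N.toMatroid.IsBase B) {b : α}
    (hb : b ∈ B) {Y : α → SignType} (hY : N.IsFundCocircuit B b Y) :
    N.fundCocircuit B b = Y :=
  (N.existsUnique_isFundCocircuit hB hb).unique (N.fundCocircuit_spec hB hb) hY

theorem fundCocircuit_eq_zero (hB : N.toMatroid.IsBase B) {b x : α} (hb : b ∈ B) (hx : x ∈ B)
    (hxb : x ≠ b) : N.fundCocircuit B b x = 0 := by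
  by_contra hne
  have : x ∈ Function.support (N.fundCocircuit B b) := hne
  rw [(N.fundCocircuit_spec hB hb).2.1] at this
  exact this.2 (N.toMatroid.subset_closure (B \ {b}) (Set.sdiff_subset.trans hB.subset_ground)
    ⟨hx, hxb⟩)

/-- A circuit through a free element is a basis plus that element, and a basis contained in B is B.
-/
theorem support_fundCircuit (hN : N.toMatroid.IsFreeElement f) (hB : N.toMatroid.IsBase B)
    (hf : f ∉ B) : Function.support (N.fundCircuit B f) = insert f B := by
  obtain ⟨hX, hs, h1⟩ := N.fundCircuit_spec hB ⟨hN.mem_ground, hf⟩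
  have hfm : f ∈ Function.support (N.fundCircuit B f) := by
    rw [Function.mem_support, h1]; decide
  have hb := hN.isBase_sdiff _ (N.isCircuit_support hX) hfm
  have := hb.eq_of_subset_isBase hB (by
    rintro x ⟨hx, hxf⟩
    exact (hs hx).resolve_left hxf)
  have h2 := congrArg (insert f) this
  rwa [Set.insert_sdiff_singleton, Set.insert_eq_of_mem hfm] at h2

theorem support_fundCocircuit (hN : N.toMatroid.dual.IsFreeElement g)
    (hB : N.toMatroid.IsBase B) (hg : g ∈ B) :
    Function.support (N.fundCocircuit B g) = N.toMatroid.E \ (B \ {g}) := by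
  obtain ⟨hY, hs, h1⟩ := N.fundCocircuit_spec hB hg
  have hgm : g ∈ Function.support (N.fundCocircuit B g) := by
    rw [Function.mem_support, h1]; decide
  have hb := hN.isBase_sdiff _ (N.isCocircuit_support hY) hgm
  have hsub : Function.support (N.fundCocircuit B g) \ {g} ⊆ N.toMatroid.E \ B := by
    rintro x ⟨hx, hxg⟩
    refine ⟨(N.isCocircuit_support hY).subset_ground hx, fun hxB => ?_⟩
    exact hx (fundCocircuit_eq_zero hB hg hxB hxg)
  have := hb.eq_of_subset_isBase hB.compl_isBase_dual hsub
  have h2 : Function.support (N.fundCocircuit B g) =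
      insert g (Function.support (N.fundCocircuit B g) \ {g}) := by
    rw [Set.insert_sdiff_singleton, Set.insert_eq_of_mem hgm]
  rw [h2, this]
  have hgE := hB.subset_ground hg
  ext x
  by_cases hxg : x = g
  · subst hxg; simp [hgE]
  · simp [hxg]

end OrientedMatroid

/-! ### Uniqueness of optimal bases and strong duality. -/

namespace OrientedMatroid

variable {α : Type*} {M N : OrientedMatroid α} {f g : α} {B : Set α}

/-- Two bases through `g` avoiding `f` agree as soon as each fundamental circuit of `f` agrees in
sign with the fundamental cocircuit of `g` for the other basis. -/
theorem isBase_eq_of_mul_nonneg (hN : N.toMatroid.IsGenericPair f g) {B₁ B₂ : Set α}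
    (hB₁ : N.toMatroid.IsBase B₁) (hg₁ : g ∈ B₁) (hf₁ : f ∉ B₁)
    (hB₂ : N.toMatroid.IsBase B₂) (hg₂ : g ∈ B₂) (hf₂ : f ∉ B₂)
    (h₁ : ∀ x ∈ B₁, x ≠ g → 0 ≤ N.fundCircuit B₁ f x * N.fundCocircuit B₂ g x)
    (h₂ : ∀ x ∈ B₂, x ≠ g → 0 ≤ N.fundCircuit B₂ f x * N.fundCocircuit B₁ g x) : B₁ = B₂ := by
  by_contra hne
  have hfE := hN.free.mem_ground
  obtain ⟨hX₁, hXs₁, hXf₁⟩ := N.fundCircuit_spec hB₁ ⟨hfE, hf₁⟩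
  obtain ⟨hX₂, hXs₂, hXf₂⟩ := N.fundCircuit_spec hB₂ ⟨hfE, hf₂⟩
  have hX₁0 := support_fundCircuit hN.free hB₁ hf₁
  have hX₂0 := support_fundCircuit hN.free hB₂ hf₂
  obtain ⟨hY₁, -, hYg₁⟩ := N.fundCocircuit_spec hB₁ hg₁
  obtain ⟨hY₂, -, hYg₂⟩ := N.fundCocircuit_spec hB₂ hg₂
  have hYs₁ := support_fundCocircuit hN.dual_free hB₁ hg₁
  have hYz₁ : ∀ x ∈ B₁, x ≠ g → N.fundCocircuit B₁ g x = 0 := fun x =>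
    fundCocircuit_eq_zero hB₁ hg₁
  have hYz₂ : ∀ x ∈ B₂, x ≠ g → N.fundCocircuit B₂ g x = 0 := fun x =>
    fundCocircuit_eq_zero hB₂ hg₂
  generalize N.fundCircuit B₁ f = X₁ at *
  generalize N.fundCircuit B₂ f = X₂ at *
  generalize N.fundCocircuit B₁ g = Y₁ at *
  generalize N.fundCocircuit B₂ g = Y₂ at *
  -- The element e only serves to keep the elimination below nontrivial.
  obtain ⟨e, heB₂, heB₁⟩ : ∃ e ∈ B₂, e ∉ B₁ := by
    by_contra! hcon
    exact hne (hB₂.eq_of_subset_isBase hB₁ hcon).symm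
  have heg : e ≠ g := by rintro rfl; exact heB₁ hg₁
  have heY₁ : Y₁ e ≠ 0 := by
    have : e ∈ Function.support Y₁ := by
      rw [hYs₁]; exact ⟨hB₂.subset_ground heB₂, fun h => heB₁ h.1⟩
    exact this
  -- Eliminate g between Y₁ and -Y₂. On B₁ \ g the cocircuit Y₁ vanishes, so V is 0 or -Y₂ there; on
  -- B₂ \ g it is 0 or Y₁. The hypotheses thus give V opposite signs relative to X₁ and to X₂.
  obtain ⟨V, hV, hVg, -, hVx⟩ := N.dual.exists_circuit_elimination hY₁
    (N.cocircuits_sig.neg_mem _ hY₂) (g := g) (e := e) (by rw [hYg₁]; decide)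
    (by rw [Pi.neg_apply, hYg₁, hYg₂]) heY₁
    (by
      rw [Pi.neg_apply, hYz₂ e heB₂ heg]
      revert heY₁; generalize Y₁ e = a; revert a; decide)
  have hmeet : ∀ B, N.toMatroid.IsBase B → ∃ x ∈ B, V x ≠ 0 := by
    intro B hB
    by_contra! hcon
    refine (N.dual.isCircuit_support hV).not_indep (hB.compl_isBase_dual.indep.subset ?_)
    intro x hx
    exact ⟨(N.dual.isCircuit_support hV).subset_ground hx, fun h => hx (hcon x h)⟩
  have hne₁ : ∀ x ∈ B₁, X₁ x ≠ 0 := fun x hx => by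
    have : x ∈ Function.support X₁ := by rw [hX₁0]; exact Or.inr hx
    exact this
  have hne₂ : ∀ x ∈ B₂, X₂ x ≠ 0 := fun x hx => by
    have : x ∈ Function.support X₂ := by rw [hX₂0]; exact Or.inr hx
    exact this
  have hs₁ : ∀ x, x ≠ f → X₁ x * V x ≤ 0 := by
    intro x hxf
    by_cases hx : X₁ x = 0
    · rw [hx, zero_mul]
    have hxB : x ∈ B₁ := (hXs₁ hx).resolve_left hxf
    by_cases hxg : x = g
    · rw [hxg, hVg, mul_zero]
    have hp := h₁ x hxB hxg
    have hz := hYz₁ x hxB hxg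
    have hv := hVx x
    rw [hz, Pi.neg_apply] at hv
    revert hp hv
    generalize X₁ x = a
    generalize Y₂ x = b
    generalize V x = c
    revert a b c
    decide
  have hs₂ : ∀ x, x ≠ f → 0 ≤ X₂ x * V x := by
    intro x hxf
    by_cases hx : X₂ x = 0
    · rw [hx, zero_mul]
    have hxB : x ∈ B₂ := (hXs₂ hx).resolve_left hxf
    by_cases hxg : x = g
    · rw [hxg, hVg, mul_zero]
    have hp := h₂ x hxB hxg
    have hz := hYz₂ x hxB hxg
    have hv := hVx x
    rw [Pi.neg_apply, hz] at hv
    revert hp hv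
    generalize X₂ x = a
    generalize Y₁ x = b
    generalize V x = c
    revert a b c
    decide
  -- A cocircuit meets every basis, hence V meets the full support of X₁. Orthogonality needs a
  -- positive product, and f is the only place left for it.
  have hVf₁ : V f = 1 := by
    obtain ⟨x, hxB, hx⟩ := hmeet B₁ hB₁
    obtain ⟨⟨p, hp⟩, -⟩ := N.orthogonal X₁ hX₁ V hV ⟨x, mul_ne_zero (hne₁ x hxB) hx⟩
    by_cases hpf : p = f
    · rwa [hpf, hXf₁, one_mul] at hp
    · have := hs₁ p hpf
      rw [hp] at this
      exact absurd this (by decide)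
  have hVf₂ : V f = -1 := by
    obtain ⟨x, hxB, hx⟩ := hmeet B₂ hB₂
    obtain ⟨-, p, hp⟩ := N.orthogonal X₂ hX₂ V hV ⟨x, mul_ne_zero (hne₂ x hxB) hx⟩
    by_cases hpf : p = f
    · rwa [hpf, hXf₂, one_mul] at hp
    · have := hs₂ p hpf
      rw [hp] at this
      exact absurd this (by decide)
  rw [hVf₁] at hVf₂
  exact absurd hVf₂ (by decide)

/-- Strong duality for generic oriented matroid programs: if a program is primal and dual feasible
then it has an optimal basis. The elements of `P` are the sign constraints, those of `D` are
deleted, and those outside `P ∪ D ∪ {f, g}` are contracted. -/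
theorem exists_optimal_of_feasible (hN : N.toMatroid.IsGenericPair f g) {P : Set α}
    (hP : P.Finite) (D : Set α) (hfP : f ∉ P) (hgP : g ∉ P) (hfD : f ∉ D) (hgD : g ∉ D)
    (hPD : ∀ x ∈ P, x ∉ D)
    (hX : ∃ X ∈ N.circuits, X f = 1 ∧ (∀ x ∈ P, 0 ≤ X x) ∧ ∀ x ∈ D, X x = 0)
    (hY : ∃ Y ∈ N.cocircuits, Y g = 1 ∧ (∀ x ∈ P, 0 ≤ Y x) ∧
      ∀ x, x ∉ P → x ∉ D → x ≠ f → x ≠ g → Y x = 0) :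
    ∃ B, N.toMatroid.IsBase B ∧ g ∈ B ∧ f ∉ B ∧ (∀ x ∈ B, x ∉ D) ∧
      (∀ x ∈ N.toMatroid.E, x ∉ P → x ∉ D → x ≠ f → x ∈ B) ∧
      ∀ x ∈ P, 0 ≤ N.fundCircuit B f x ∧ 0 ≤ N.fundCocircuit B g x := by
  have hfE := hN.free.mem_ground
  have hgE : g ∈ N.toMatroid.E := hN.dual_free.mem_ground
  have hne := hN.ne
  induction P, hP using Set.Finite.induction_on generalizing D with
  | empty =>
    obtain ⟨X, hX, hXf, -, hXD⟩ := hX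
    obtain ⟨Y, hY, hYg, -, hYK⟩ := hY
    -- With no constraint left, both feasible signed sets define a basis by genericity. Every
    -- element other than f and g is deleted or contracted, so the two bases coincide.
    have hB := hN.free.isBase_sdiff _ (N.isCircuit_support hX)
      (show X f ≠ 0 by rw [hXf]; decide)
    have hB' := (hN.dual_free.isBase_sdiff _ (N.isCocircuit_support hY)
      (show Y g ≠ 0 by rw [hYg]; decide)).compl_isBase_of_dual
    have heq := hB.eq_of_subset_isBase hB' (by
      rintro x ⟨hx, hxf⟩
      refine ⟨(N.isCircuit_support hX).subset_ground hx, ?_⟩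
      rintro ⟨hxY, hxg⟩
      exact hxY (hYK x (fun h => h) (fun h => hx (hXD x h)) hxf hxg))
    refine ⟨_, hB, ?_, fun h => h.2 rfl, fun x hx hxD => hx.1 (hXD x hxD), ?_,
      fun x hx => hx.elim⟩
    · rw [heq]; exact ⟨hgE, fun h => h.2 rfl⟩
    · intro x hxE hxP hxD hxf
      rw [heq]
      refine ⟨hxE, ?_⟩
      rintro ⟨hxY, hxg⟩
      exact hxY (hYK x hxP hxD hxf hxg)
  | @insert x P hxP hPfin ih =>
    obtain ⟨X, hX, hXf, hXP, hXD⟩ := hX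
    obtain ⟨Y, hY, hYg, hYP, hYK⟩ := hY
    have hfP' : f ∉ P := fun h => hfP (Or.inr h)
    have hgP' : g ∉ P := fun h => hgP (Or.inr h)
    have hxf : x ≠ f := by rintro rfl; exact hfP (Or.inl rfl)
    have hxg : x ≠ g := by rintro rfl; exact hgP (Or.inl rfl)
    have hxD : x ∉ D := hPD x (Or.inl rfl)
    have hPD' : ∀ y ∈ P, y ∉ D := fun y hy => hPD y (Or.inr hy)
    have hPxD : ∀ y ∈ P, y ∉ insert x D := by
      rintro y hy (rfl | h)
      · exact hxP hy
      · exact hPD' y hy h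
    -- dual feasibility after deleting `x`
    have hdel : (∃ B, N.toMatroid.IsBase B ∧ g ∈ B ∧ f ∉ B ∧ (∀ y ∈ B, y ∉ insert x D) ∧
        (∀ y ∈ N.toMatroid.E, y ∉ P → y ∉ insert x D → y ≠ f → y ∈ B) ∧
        ∀ y ∈ P, 0 ≤ N.fundCircuit B f y ∧ 0 ≤ N.fundCocircuit B g y) ∨
        ∃ Z ∈ N.cocircuits, Z f = 1 ∧ (∀ y ∈ P, 0 ≤ Z y) ∧
          ∀ y, y ∉ P → y ∉ D → y ≠ x → y ≠ f → Z y = 0 := by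
      rcases N.exists_circuit_or_cocircuit hfE (fun _ => 1) (by decide) hPfin (insert x D)
        (fun _ _ => by decide) hfP' (by rintro (h | h); exacts [hxf h.symm, hfD h]) hPxD with
        ⟨X', hX', hX'f, hX'P, hX'D⟩ | ⟨Z, hZ, hZf, hZP, hZK⟩
      · left
        refine ih (insert x D) hfP' hgP' (by rintro (h | h); exacts [hxf h.symm, hfD h])
          (by rintro (h | h); exacts [hxg h.symm, hgD h]) hPxD
          ⟨X', hX', hX'f, fun y hy => by simpa using hX'P y hy, hX'D⟩
          ⟨Y, hY, hYg, fun y hy => hYP y (Or.inr hy), ?_⟩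
        intro y hy hyD
        refine hYK y ?_ (fun h => hyD (Or.inr h))
        rintro (h | h)
        · exact hyD (Or.inl h)
        · exact hy h
      · right
        refine ⟨Z, hZ, hZf, fun y hy => by simpa using hZP y hy, fun y hy hyD hyx => ?_⟩
        exact hZK y hy (by rintro (h | h); exacts [hyx h, hyD h])
    -- primal feasibility after contracting `x`
    have hcon : (∃ B, N.toMatroid.IsBase B ∧ g ∈ B ∧ f ∉ B ∧ (∀ y ∈ B, y ∉ D) ∧
        (∀ y ∈ N.toMatroid.E, y ∉ P → y ∉ D → y ≠ f → y ∈ B) ∧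
        ∀ y ∈ P, 0 ≤ N.fundCircuit B f y ∧ 0 ≤ N.fundCocircuit B g y) ∨
        ∃ Z ∈ N.circuits, Z g = 1 ∧ (∀ y ∈ P, 0 ≤ Z y) ∧ (∀ y ∈ D, Z y = 0) ∧ Z f = 0 := by
      rcases N.dual.exists_circuit_or_cocircuit hgE (fun _ => 1) (by decide) hPfin
        {y | y ∉ P ∧ y ∉ D ∧ y ≠ f ∧ y ≠ g}
        (fun _ _ => by decide) hgP' (fun h => h.2.2.2 rfl) (fun y hy h => h.1 hy) with
        ⟨Y', hY', hY'f, hY'P, hY'K⟩ | ⟨Z, hZ, hZg, hZP, hZD⟩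
      · left
        exact ih D hfP' hgP' hfD hgD hPD'
          ⟨X, hX, hXf, fun y hy => hXP y (Or.inr hy), hXD⟩
          ⟨Y', hY', hY'f, fun y hy => by simpa using hY'P y hy,
            fun y h1 h2 h3 h4 => hY'K y ⟨h1, h2, h3, h4⟩⟩
      · right
        refine ⟨Z, hZ, hZg, fun y hy => by simpa using hZP y hy, fun y hy => ?_, ?_⟩
        · exact hZD y (fun h => hPD' y h hy) (fun h => h.2.1 hy) (by rintro rfl; exact hgD hy)
        · exact hZD f hfP' (fun h => h.2.2.1 rfl) hne
    -- An optimal basis after deleting x avoids x, so only the sign of its cocircuit at x must be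
    -- checked. Dually, after contracting x only the sign of the circuit at x is in question.
    by_cases hopt₁ : ∃ B, N.toMatroid.IsBase B ∧ g ∈ B ∧ f ∉ B ∧ (∀ y ∈ B, y ∉ insert x D) ∧
        (∀ y ∈ N.toMatroid.E, y ∉ P → y ∉ insert x D → y ≠ f → y ∈ B) ∧
        (∀ y ∈ P, 0 ≤ N.fundCircuit B f y ∧ 0 ≤ N.fundCocircuit B g y) ∧
        0 ≤ N.fundCocircuit B g x
    · obtain ⟨B, hB, hgB, hfB, hBD, hBK, hBP, hBx⟩ := hopt₁
      refine ⟨B, hB, hgB, hfB, fun y hy h => hBD y hy (Or.inr h), ?_, ?_⟩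
      · intro y hyE hy hyD hyf
        refine hBK y hyE (fun h => hy (Or.inr h)) ?_ hyf
        rintro (h | h)
        · exact hy (Or.inl h)
        · exact hyD h
      · rintro y (rfl | hy)
        · refine ⟨?_, hBx⟩
          have : N.fundCircuit B f y = 0 := by
            by_contra h
            rcases (N.fundCircuit_spec hB ⟨hfE, hfB⟩).2.1 h with h | h
            · exact hxf h
            · exact hBD y h (Or.inl rfl)
          rw [this]
        · exact hBP y hy
    by_cases hopt₂ : ∃ B, N.toMatroid.IsBase B ∧ g ∈ B ∧ f ∉ B ∧ (∀ y ∈ B, y ∉ D) ∧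
        (∀ y ∈ N.toMatroid.E, y ∉ P → y ∉ D → y ≠ f → y ∈ B) ∧
        (∀ y ∈ P, 0 ≤ N.fundCircuit B f y ∧ 0 ≤ N.fundCocircuit B g y) ∧
        0 ≤ N.fundCircuit B f x ∧ x ∈ N.toMatroid.E
    · obtain ⟨B, hB, hgB, hfB, hBD, hBK, hBP, hBx, hxE⟩ := hopt₂
      refine ⟨B, hB, hgB, hfB, hBD, ?_, ?_⟩
      · intro y hyE hy hyD hyf
        exact hBK y hyE (fun h => hy (Or.inr h)) hyD hyf
      · rintro y (rfl | hy)
        · refine ⟨hBx, ?_⟩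
          rw [fundCocircuit_eq_zero hB hgB (hBK y hxE hxP hxD hxf) hxg]
        · exact hBP y hy
    -- Otherwise each of the two problems provides a signed set equal to -1 at x: one of an optimal
    -- basis, or a certificate of infeasibility. Each of the four combinations is contradictory.
    exfalso
    have hbad₁ : ∀ B, N.toMatroid.IsBase B ∧ g ∈ B ∧ f ∉ B ∧ (∀ y ∈ B, y ∉ insert x D) ∧
        (∀ y ∈ N.toMatroid.E, y ∉ P → y ∉ insert x D → y ≠ f → y ∈ B) ∧
        (∀ y ∈ P, 0 ≤ N.fundCircuit B f y ∧ 0 ≤ N.fundCocircuit B g y) →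
        N.fundCocircuit B g x = -1 := by
      rintro B ⟨h1, h2, h3, h4, h5, h6⟩
      have : ¬ 0 ≤ N.fundCocircuit B g x := fun h => hopt₁ ⟨B, h1, h2, h3, h4, h5, h6, h⟩
      revert this; generalize N.fundCocircuit B g x = a; revert a; decide
    have hbad₂ : ∀ B, N.toMatroid.IsBase B ∧ g ∈ B ∧ f ∉ B ∧ (∀ y ∈ B, y ∉ D) ∧
        (∀ y ∈ N.toMatroid.E, y ∉ P → y ∉ D → y ≠ f → y ∈ B) ∧
        (∀ y ∈ P, 0 ≤ N.fundCircuit B f y ∧ 0 ≤ N.fundCocircuit B g y) →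
        x ∈ N.toMatroid.E → N.fundCircuit B f x = -1 := by
      rintro B ⟨h1, h2, h3, h4, h5, h6⟩ hxE
      have : ¬ 0 ≤ N.fundCircuit B f x := fun h => hopt₂ ⟨B, h1, h2, h3, h4, h5, h6, h, hxE⟩
      revert this; generalize N.fundCircuit B f x = a; revert a; decide
    have hneg : ∀ a : SignType, ¬ 0 ≤ a → a = -1 := by decide
    -- A certificate of infeasibility must be negative at x, since otherwise it would contradict the
    -- feasible X (or Y, for `hray₂`) of the full problem.
    have hray₁ : ∀ Z ∈ N.cocircuits, Z f = 1 → (∀ y ∈ P, 0 ≤ Z y) →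
        (∀ y, y ∉ P → y ∉ D → y ≠ x → y ≠ f → Z y = 0) → Z x = -1 := by
      intro Z hZ hZf hZP hZK
      refine hneg _ fun h => ?_
      refine (N.orthogonal X hX Z hZ).false_of_nonneg f (by rw [hXf, hZf]; decide) fun y => ?_
      by_cases h1 : y = f
      · rw [h1, hXf, hZf]; decide
      by_cases h2 : y = x
      · rw [h2]; exact SignType.mul_nonneg_of (hXP x (Or.inl rfl)) h
      by_cases h3 : y ∈ P
      · exact SignType.mul_nonneg_of (hXP y (Or.inr h3)) (hZP y h3)
      by_cases h4 : y ∈ D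
      · rw [hXD y h4, zero_mul]
      · rw [hZK y h3 h4 h2 h1, mul_zero]
    have hray₂ : ∀ Z ∈ N.circuits, Z g = 1 → (∀ y ∈ P, 0 ≤ Z y) → (∀ y ∈ D, Z y = 0) →
        Z f = 0 → Z x = -1 := by
      intro Z hZ hZg hZP hZD hZf
      refine hneg _ fun h => ?_
      refine (N.orthogonal Z hZ Y hY).false_of_nonneg g (by rw [hYg, hZg]; decide) fun y => ?_
      by_cases h1 : y = g
      · rw [h1, hYg, hZg]; decide
      by_cases h2 : y = x
      · rw [h2]; exact SignType.mul_nonneg_of h (hYP x (Or.inl rfl))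
      by_cases h3 : y ∈ P
      · exact SignType.mul_nonneg_of (hZP y h3) (hYP y (Or.inr h3))
      by_cases h4 : y ∈ D
      · rw [hZD y h4, zero_mul]
      by_cases h5 : y = f
      · rw [h5, hZf, zero_mul]
      · rw [hYK y (by rintro (h | h); exacts [h2 h, h3 h]) h4 h5 h1, mul_zero]
    rcases hdel with ⟨B₁, hB₁⟩ | ⟨Z₁, hZ₁, hZ₁f, hZ₁P, hZ₁K⟩
    · have hx₁ := hbad₁ B₁ hB₁
      obtain ⟨hB₁, hg₁, hf₁, hD₁, hK₁, hP₁⟩ := hB₁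
      obtain ⟨hY₁, -, hYg₁⟩ := N.fundCocircuit_spec hB₁ hg₁
      have hxE : x ∈ N.toMatroid.E := by
        by_contra h
        rw [N.cocircuit_eq_zero hY₁ h] at hx₁
        exact absurd hx₁ (by decide)
      have hYz₁ : ∀ y ∈ N.toMatroid.E, y ∉ P → y ∉ D → y ≠ x → y ≠ f → y ≠ g →
          N.fundCocircuit B₁ g y = 0 := by
        intro y h1 h2 h3 h4 h5 h6
        exact fundCocircuit_eq_zero hB₁ hg₁
          (hK₁ y h1 h2 (by rintro (h | h); exacts [h4 h, h3 h]) h5) h6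
      rcases hcon with ⟨B₂, hB₂⟩ | ⟨Z₂, hZ₂, hZ₂g, hZ₂P, hZ₂D, hZ₂f⟩
      · have hx₂ := hbad₂ B₂ hB₂ hxE
        obtain ⟨hB₂, hg₂, hf₂, hD₂, hK₂, hP₂⟩ := hB₂
        -- The two wrong signs at x multiply to a nonnegative product, so uniqueness applies; but x
        -- lies in B₂ and not in B₁.
        have heq : B₁ = B₂ := by
          refine isBase_eq_of_mul_nonneg hN hB₁ hg₁ hf₁ hB₂ hg₂ hf₂ ?_ ?_
          · intro y hy hyg
            have hyf : y ≠ f := by rintro rfl; exact hf₁ hy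
            by_cases h3 : y ∈ P
            · exact SignType.mul_nonneg_of (hP₁ y h3).1 (hP₂ y h3).2
            · rw [fundCocircuit_eq_zero hB₂ hg₂ (hK₂ y (hB₁.subset_ground hy) h3
                (fun h => hD₁ y hy (Or.inr h)) hyf) hyg, mul_zero]
          · intro y hy hyg
            have hyf : y ≠ f := by rintro rfl; exact hf₂ hy
            by_cases h2 : y = x
            · rw [h2, hx₁, hx₂]; decide
            by_cases h3 : y ∈ P
            · exact SignType.mul_nonneg_of (hP₂ y h3).1 (hP₁ y h3).2
            · rw [hYz₁ y (hB₂.subset_ground hy) h3 (hD₂ y hy) h2 hyf hyg, mul_zero]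
        exact hD₁ x (heq ▸ hK₂ x hxE hxP hxD hxf) (Or.inl rfl)
      · have hx₂ := hray₂ Z₂ hZ₂ hZ₂g hZ₂P hZ₂D hZ₂f
        refine (N.orthogonal Z₂ hZ₂ _ hY₁).false_of_nonneg g (by rw [hZ₂g, hYg₁]; decide)
          fun y => ?_
        by_cases h1 : y = g
        · rw [h1, hZ₂g, hYg₁]; decide
        by_cases h2 : y = x
        · rw [h2, hx₁, hx₂]; decide
        by_cases h3 : y ∈ P
        · exact SignType.mul_nonneg_of (hZ₂P y h3) (hP₁ y h3).2
        by_cases h4 : y ∈ D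
        · rw [hZ₂D y h4, zero_mul]
        by_cases h5 : y = f
        · rw [h5, hZ₂f, zero_mul]
        by_cases h6 : y ∈ N.toMatroid.E
        · rw [hYz₁ y h6 h3 h4 h2 h5 h1, mul_zero]
        · rw [N.circuit_eq_zero hZ₂ h6, zero_mul]
    · have hx₁ := hray₁ Z₁ hZ₁ hZ₁f hZ₁P hZ₁K
      have hxE : x ∈ N.toMatroid.E := by
        by_contra h
        rw [N.cocircuit_eq_zero hZ₁ h] at hx₁
        exact absurd hx₁ (by decide)
      rcases hcon with ⟨B₂, hB₂⟩ | ⟨Z₂, hZ₂, hZ₂g, hZ₂P, hZ₂D, hZ₂f⟩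
      · have hx₂ := hbad₂ B₂ hB₂ hxE
        obtain ⟨hB₂, hg₂, hf₂, hD₂, hK₂, hP₂⟩ := hB₂
        obtain ⟨hX₂, hXs₂, hXf₂⟩ := N.fundCircuit_spec hB₂ ⟨hfE, hf₂⟩
        refine (N.orthogonal _ hX₂ Z₁ hZ₁).false_of_nonneg f (by rw [hZ₁f, hXf₂]; decide)
          fun y => ?_
        by_cases h1 : y = f
        · rw [h1, hZ₁f, hXf₂]; decide
        by_cases h2 : y = x
        · rw [h2, hx₁, hx₂]; decide
        by_cases h3 : y ∈ P
        · exact SignType.mul_nonneg_of (hP₂ y h3).1 (hZ₁P y h3)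
        by_cases h4 : y ∈ D
        · have : N.fundCircuit B₂ f y = 0 := by
            by_contra h
            exact hD₂ y ((hXs₂ h).resolve_left h1) h4
          rw [this, zero_mul]
        · rw [hZ₁K y h3 h4 h2 h1, mul_zero]
      · have hx₂ := hray₂ Z₂ hZ₂ hZ₂g hZ₂P hZ₂D hZ₂f
        refine (N.orthogonal Z₂ hZ₂ Z₁ hZ₁).false_of_nonneg x (by rw [hx₁, hx₂]; decide)
          fun y => ?_
        by_cases h1 : y = f
        · rw [h1, hZ₂f, zero_mul]
        by_cases h2 : y = x
        · rw [h2, hx₁, hx₂]; decide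
        by_cases h3 : y ∈ P
        · exact SignType.mul_nonneg_of (hZ₂P y h3) (hZ₁P y h3)
        by_cases h4 : y ∈ D
        · rw [hZ₂D y h4, zero_mul]
        · rw [hZ₁K y h3 h4 h2 h1, mul_zero]

end OrientedMatroid

/-! ### Boundedness as feasibility, and optimal bases of bounded regions. -/

namespace OrientedMatroid

variable {α : Type*} {M N : OrientedMatroid α} {f g : α} {B : Set α}

/-- The painting lemma with every sign prescribed to be positive and nothing deleted or contracted.
-/
theorem exists_positive_circuit_or_cocircuit (N : OrientedMatroid α) {e : α}
    (he : e ∈ N.toMatroid.E) :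
    (∃ X ∈ N.circuits, X e = 1 ∧ ∀ x, 0 ≤ X x) ∨
      (∃ Y ∈ N.cocircuits, Y e = 1 ∧ ∀ x, 0 ≤ Y x) := by
  rcases N.exists_circuit_or_cocircuit he (fun _ => 1) (by decide)
    (N.ground_finite.subset (Set.sdiff_subset (t := {e}))) ∅
    (fun _ _ => by decide) (fun h => h.2 rfl) (fun h => h) (fun _ _ h => h) with
    ⟨X, hX, hXe, hXP, -⟩ | ⟨Y, hY, hYe, hYP, -⟩
  · refine Or.inl ⟨X, hX, hXe, fun x => ?_⟩
    by_cases hxe : x = e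
    · rw [hxe, hXe]; decide
    by_cases hxE : x ∈ N.toMatroid.E
    · simpa using hXP x ⟨hxE, hxe⟩
    · rw [N.circuit_eq_zero hX hxE]
  · refine Or.inr ⟨Y, hY, hYe, fun x => ?_⟩
    by_cases hxe : x = e
    · rw [hxe, hYe]; decide
    by_cases hxE : x ∈ N.toMatroid.E
    · simpa using hYP x ⟨hxE, hxe⟩
    · rw [N.cocircuit_eq_zero hY hxE]

theorem totallyCyclic_iff_acyclic_dual (N : OrientedMatroid α) :
    N.TotallyCyclic ↔ N.dual.Acyclic := by
  constructor
  · rintro h ⟨Y, hY, hYp⟩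
    obtain ⟨e, he⟩ := (N.dual.isCircuit_support hY).nonempty
    obtain ⟨X, hX, hXp, hXe⟩ := h e ((N.dual.isCircuit_support hY).subset_ground he)
    exact (N.orthogonal X hX Y hY).false_of_nonneg e (mul_ne_zero hXe he)
      fun x => SignType.mul_nonneg_of (hXp x) (hYp x)
  · intro h e he
    rcases N.exists_positive_circuit_or_cocircuit he with ⟨X, hX, hXe, hXp⟩ | ⟨Y, hY, -, hYp⟩
    · exact ⟨X, hX, hXp, by rw [hXe]; decide⟩
    · exact absurd ⟨Y, hY, hYp⟩ h

theorem totallyCyclic_contract_iff (N : OrientedMatroid α) (g : α) :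
    (N.contract g).TotallyCyclic ↔ (N.dual.delete g).Acyclic :=
  (N.contract g).totallyCyclic_iff_acyclic_dual

theorem exists_mem_isBase_cocircuit_ne_zero (hB : N.toMatroid.IsBase B) {Y : α → SignType}
    (hY : Y ∈ N.cocircuits) : ∃ x ∈ B, Y x ≠ 0 := by
  by_contra! hcon
  refine (N.dual.isCircuit_support hY).not_indep (hB.compl_isBase_dual.indep.subset ?_)
  intro x hx
  exact ⟨(N.dual.isCircuit_support hY).subset_ground hx, fun h => hx (hcon x h)⟩

theorem exists_notMem_isBase_circuit_ne_zero (hB : N.toMatroid.IsBase B) {X : α → SignType}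
    (hX : X ∈ N.circuits) : ∃ x, x ∉ B ∧ X x ≠ 0 := by
  by_contra! hcon
  refine (N.isCircuit_support hX).not_indep (hB.indep.subset fun x hx => ?_)
  by_contra h
  exact hx (hcon x h)

theorem fundCocircuit_ne_zero (hN : N.toMatroid.IsGenericPair f g) (hB : N.toMatroid.IsBase B)
    (hg : g ∈ B) {x : α} (hxE : x ∈ N.toMatroid.E) (hx : x ∉ B) :
    N.fundCocircuit B g x ≠ 0 := by
  have : x ∈ Function.support (N.fundCocircuit B g) := by
    rw [support_fundCocircuit hN.dual_free hB hg]; exact ⟨hxE, fun h => hx h.1⟩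
  exact this

theorem fundCircuit_ne_zero (hN : N.toMatroid.IsGenericPair f g) (hB : N.toMatroid.IsBase B)
    (hf : f ∉ B) {x : α} (hx : x ∈ B) : N.fundCircuit B f x ≠ 0 := by
  have : x ∈ Function.support (N.fundCircuit B f) := by
    rw [support_fundCircuit hN.free hB hf]; exact Or.inr hx
  exact this

/-- A circuit has an element outside B, and there C*(B;g) is nonzero by genericity. A positive
circuit avoiding f would therefore meet C*(B;g) with no disagreement. -/
theorem IsOptimalBasis.acyclic_delete (hN : N.toMatroid.IsGenericPair f g)
    (h : N.IsOptimalBasis g f B) : (N.delete f).Acyclic := by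
  rintro ⟨X, ⟨hX, hXf⟩, hXp⟩
  obtain ⟨hB, hg, hf, hYp, -⟩ := h
  obtain ⟨x, hxB, hx⟩ := exists_notMem_isBase_circuit_ne_zero hB hX
  refine (N.orthogonal X hX _ (N.fundCocircuit_spec hB hg).1).false_of_nonneg x
    (mul_ne_zero hx (fundCocircuit_ne_zero hN hB hg
      ((N.isCircuit_support hX).subset_ground hx) hxB)) fun y => ?_
  by_cases hyf : y = f
  · rw [hyf, hXf, zero_mul]
  · exact SignType.mul_nonneg_of (hXp y) (hYp y hyf)

theorem IsOptimalBasis.totallyCyclic_contract (hN : N.toMatroid.IsGenericPair f g)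
    (h : N.IsOptimalBasis g f B) : (N.contract g).TotallyCyclic := by
  rw [totallyCyclic_contract_iff]
  rintro ⟨Y, ⟨hY, hYg⟩, hYp⟩
  obtain ⟨hB, hg, hf, -, hXp⟩ := h
  obtain ⟨x, hxB, hx⟩ := exists_mem_isBase_cocircuit_ne_zero hB hY
  refine (N.orthogonal _ (N.fundCircuit_spec hB ⟨hN.free.mem_ground, hf⟩).1 Y hY).false_of_nonneg
    x (mul_ne_zero (fundCircuit_ne_zero hN hB hf hxB) hx) fun y => ?_
  by_cases hyg : y = g
  · rw [hyg, hYg, mul_zero]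
  · exact SignType.mul_nonneg_of (hXp y hyg) (hYp y)

theorem IsOptimalBasis.eq (hN : N.toMatroid.IsGenericPair f g) {B₁ B₂ : Set α}
    (h₁ : N.IsOptimalBasis g f B₁) (h₂ : N.IsOptimalBasis g f B₂) : B₁ = B₂ := by
  obtain ⟨hB₁, hg₁, hf₁, hY₁, hX₁⟩ := h₁
  obtain ⟨hB₂, hg₂, hf₂, hY₂, hX₂⟩ := h₂
  exact isBase_eq_of_mul_nonneg hN hB₁ hg₁ hf₁ hB₂ hg₂ hf₂
    (fun x hx hxg => SignType.mul_nonneg_of (hX₁ x hxg)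
      (hY₂ x (by rintro rfl; exact hf₁ hx)))
    (fun x hx hxg => SignType.mul_nonneg_of (hX₂ x hxg)
      (hY₁ x (by rintro rfl; exact hf₂ hx)))

/-- The painting lemma at g with f deleted: acyclicity excludes the circuit alternative. -/
theorem exists_feasible_cocircuit (hfg : f ≠ g) (hg : g ∈ N.toMatroid.E)
    (h : (N.delete f).Acyclic) :
    ∃ Y ∈ N.cocircuits, Y g = 1 ∧ ∀ x, x ≠ f → 0 ≤ Y x := by
  rcases N.exists_circuit_or_cocircuit hg (fun _ => 1) (by decide)
    (N.ground_finite.subset (Set.sdiff_subset (t := {f, g}))) {f}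
    (fun _ _ => by decide) (fun h => h.2 (Or.inr rfl)) (fun h => hfg h.symm)
    (fun x hx h => hx.2 (Or.inl h)) with
    ⟨X, hX, hXg, hXP, hXf⟩ | ⟨Y, hY, hYg, hYP, -⟩
  · refine absurd ⟨X, ⟨hX, hXf f rfl⟩, fun x => ?_⟩ h
    by_cases hxf : x = f
    · rw [hxf, hXf f rfl]
    by_cases hxg : x = g
    · rw [hxg, hXg]; decide
    by_cases hxE : x ∈ N.toMatroid.E
    · simpa using hXP x ⟨hxE, by rintro (h | h); exacts [hxf h, hxg h]⟩
    · rw [N.circuit_eq_zero hX hxE]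
  · refine ⟨Y, hY, hYg, fun x hxf => ?_⟩
    by_cases hxg : x = g
    · rw [hxg, hYg]; decide
    by_cases hxE : x ∈ N.toMatroid.E
    · simpa using hYP x ⟨hxE, by rintro (h | h); exacts [hxf h, hxg h]⟩
    · rw [N.cocircuit_eq_zero hY hxE]

theorem exists_isOptimalBasis (hN : N.toMatroid.IsGenericPair f g) (ha : (N.delete f).Acyclic)
    (ht : (N.contract g).TotallyCyclic) : ∃ B, N.IsOptimalBasis g f B := by
  rw [totallyCyclic_contract_iff] at ht
  obtain ⟨Y, hY, hYg, hYp⟩ := exists_feasible_cocircuit hN.ne hN.dual_free.mem_ground ha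
  obtain ⟨X, hX, hXf, hXp⟩ := exists_feasible_cocircuit (N := N.dual) hN.ne.symm
    hN.free.mem_ground ht
  obtain ⟨B, hB, hg, hf, -, -, hP⟩ := exists_optimal_of_feasible hN
    (N.ground_finite.subset (Set.sdiff_subset (t := {f, g}))) ∅
    (fun h => h.2 (Or.inl rfl)) (fun h => h.2 (Or.inr rfl)) (fun h => h) (fun h => h)
    (fun _ _ h => h)
    ⟨X, hX, hXf, fun x hx => hXp x fun h => hx.2 (Or.inr h), fun _ h => h.elim⟩
    ⟨Y, hY, hYg, fun x hx => hYp x fun h => hx.2 (Or.inl h), fun x hx _ hxf hxg => by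
      by_contra h
      exact hx ⟨(N.isCocircuit_support hY).subset_ground h, by
        rintro (h | h); exacts [hxf h, hxg h]⟩⟩
  have hXB := N.fundCircuit_spec hB ⟨hN.free.mem_ground, hf⟩
  have hYB := N.fundCocircuit_spec hB hg
  refine ⟨B, hB, hg, hf, fun x hxf => ?_, fun x hxg => ?_⟩
  · by_cases hxg : x = g
    · rw [hxg, hYB.2.2]; decide
    by_cases hxE : x ∈ N.toMatroid.E
    · exact (hP x ⟨hxE, by rintro (h | h); exacts [hxf h, hxg h]⟩).2
    · rw [N.cocircuit_eq_zero hYB.1 hxE]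
  · by_cases hxf : x = f
    · rw [hxf, hXB.2.2]; decide
    by_cases hxE : x ∈ N.toMatroid.E
    · exact (hP x ⟨hxE, by rintro (h | h); exacts [hxf h, hxg h]⟩).1
    · rw [N.circuit_eq_zero hXB.1 hxE]

/-! Fully optimal bases. -/

section FullyOptimal

variable [LinearOrder α]

theorem oppositeToMin_iff {X : α → SignType} {e m : α} (hm : IsLeast (Function.support X) m) :
    OppositeToMin X e ↔ X m = -X e := by
  constructor
  · rintro ⟨m', hm', h⟩
    rwa [hm.unique hm']
  · exact fun h => ⟨m, hm, h⟩

variable (hgE : IsLeast N.toMatroid.E g) (hfE : ∀ x ∈ N.toMatroid.E, x ≠ g → f ≤ x)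
include hgE

theorem isLeast_support_circuit_of_ne_zero {X : α → SignType} (hX : X ∈ N.circuits)
    (h : X g ≠ 0) : IsLeast (Function.support X) g :=
  ⟨h, fun _ hx => hgE.2 ((N.isCircuit_support hX).subset_ground hx)⟩

include hfE

omit hgE in
theorem isLeast_support_cocircuit_of_ne_zero {Y : α → SignType} (hY : Y ∈ N.cocircuits)
    (hg : Y g = 0) (h : Y f ≠ 0) : IsLeast (Function.support Y) f :=
  ⟨h, fun x hx => hfE x ((N.isCocircuit_support hY).subset_ground hx)
    (by rintro rfl; exact hx hg)⟩

/-- Whenever C(B;x) contains g, its smallest element is g; when C*(B;b) contains f but not g, its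
smallest element is f. Genericity guarantees that these elements are present, so the sign conditions
concern the entries at g and f, which are those of C*(B;g) and C(B;f) up to sign. -/
theorem IsFullyOptimalBasis.isOptimalBasis (hN : N.toMatroid.IsGenericPair f g)
    (h : N.IsFullyOptimalBasis B) : N.IsOptimalBasis g f B := by
  obtain ⟨hB, hopC, hopD⟩ := h
  have hsgn : ∀ a : SignType, a = -a → a ≠ 1 := by decide
  have hfm := hN.free.mem_ground
  -- Were g outside B, it would be the smallest element of C(B;g) and its sign opposite to itself.
  -- The same argument with C*(B;f) excludes f from B.
  have hg : g ∈ B := by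
    by_contra hg
    have hs := N.fundCircuit_spec hB ⟨hgE.1, hg⟩
    have h := (oppositeToMin_iff (isLeast_support_circuit_of_ne_zero hgE hs.1
      (by rw [hs.2.2]; decide))).1 (hopC g ⟨hgE.1, hg⟩)
    exact hsgn _ h hs.2.2
  have hf : f ∉ B := by
    intro hf
    have hs := N.fundCocircuit_spec hB hf
    have h := (oppositeToMin_iff (isLeast_support_cocircuit_of_ne_zero hfE hs.1
      (fundCocircuit_eq_zero hB hf hg hN.ne.symm) (by rw [hs.2.2]; decide))).1
      (hopD f hf (fun h => hN.ne (h.unique hgE)))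
    exact hsgn _ h hs.2.2
  refine ⟨hB, hg, hf, fun x hxf => ?_, fun x hxg => ?_⟩
  · have hYg := N.fundCocircuit_spec hB hg
    by_cases hxE : x ∈ N.toMatroid.E
    · by_cases hxB : x ∈ B
      · by_cases hxg : x = g
        · rw [hxg, hYg.2.2]; decide
        · rw [fundCocircuit_eq_zero hB hg hxB hxg]
      · have hs := N.fundCircuit_spec hB ⟨hxE, hxB⟩
        have heq := fundCocircuit_eq_neg_fundCircuit hB hg ⟨hxE, hxB⟩
        have hne := fundCocircuit_ne_zero hN hB hg hxE hxB
        have h := (oppositeToMin_iff (isLeast_support_circuit_of_ne_zero hgE hs.1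
          (by intro h; rw [heq, h] at hne; exact hne rfl))).1 (hopC x ⟨hxE, hxB⟩)
        rw [heq, h, hs.2.2]; decide
    · rw [N.cocircuit_eq_zero hYg.1 hxE]
  · have hXf := N.fundCircuit_spec hB ⟨hfm, hf⟩
    by_cases hxB : x ∈ B
    · have hs := N.fundCocircuit_spec hB hxB
      have heq := fundCocircuit_eq_neg_fundCircuit hB hxB ⟨hfm, hf⟩
      have hne := fundCircuit_ne_zero hN hB hf hxB
      have h := (oppositeToMin_iff (isLeast_support_cocircuit_of_ne_zero hfE hs.1
        (fundCocircuit_eq_zero hB hxB hg (Ne.symm hxg))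
        (by
          rw [heq]; revert hne; generalize N.fundCircuit B f x = a; revert a; decide))).1
        (hopD x hxB (fun h => hxg (h.unique hgE)))
      rw [h, hs.2.2] at heq
      revert heq; generalize N.fundCircuit B f x = a; revert a; decide
    · by_cases hxf : x = f
      · rw [hxf, hXf.2.2]; decide
      · have : N.fundCircuit B f x = 0 := by
          by_contra h
          exact (hXf.2.1 h).elim hxf hxB
        rw [this]

/-- Full optimality also needs C*(B;g) to be positive at f, on which optimality is silent.
Genericity makes this entry nonzero and compliance makes it positive. -/
theorem IsOptimalBasis.isFullyOptimalBasis (hN : N.toMatroid.IsGenericPair f g)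
    (hcomp : N.IsCompliant f g) (h : N.IsOptimalBasis g f B) : N.IsFullyOptimalBasis B := by
  obtain ⟨hB, hg, hf, hYp, hXp⟩ := h
  have hfm := hN.free.mem_ground
  have hYg := N.fundCocircuit_spec hB hg
  have hpos : ∀ x ∈ N.toMatroid.E, x ∉ B → N.fundCocircuit B g x = 1 := by
    intro x hxE hxB
    have hne := fundCocircuit_ne_zero hN hB hg hxE hxB
    have hnn : N.fundCocircuit B g x ≠ -1 := by
      by_cases hxf : x = f
      · rw [hxf]; exact fun h => hcomp ⟨_, hYg.1, hYg.2.2, h⟩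
      · intro h
        have := hYp x hxf
        rw [h] at this
        exact absurd this (by decide)
    revert hne hnn; generalize N.fundCocircuit B g x = a; revert a; decide
  refine ⟨hB, fun x hx => ?_, fun b hb hbg => ?_⟩
  · have hs := N.fundCircuit_spec hB hx
    have heq := fundCocircuit_eq_neg_fundCircuit hB hg hx
    rw [hpos x hx.1 hx.2] at heq
    have hval : N.fundCircuit B x g = -1 := by
      revert heq; generalize N.fundCircuit B x g = a; revert a; decide
    rw [oppositeToMin_iff (isLeast_support_circuit_of_ne_zero hgE hs.1
      (by rw [hval]; decide)), hval, hs.2.2]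
  · have hbg' : b ≠ g := by rintro rfl; exact hbg hgE
    have hs := N.fundCocircuit_spec hB hb
    have heq := fundCocircuit_eq_neg_fundCircuit hB hb ⟨hfm, hf⟩
    have hX1 : N.fundCircuit B f b = 1 := by
      have h1 := hXp b hbg'
      have h2 := fundCircuit_ne_zero hN hB hf hb
      revert h1 h2; generalize N.fundCircuit B f b = a; revert a; decide
    rw [hX1] at heq
    rw [oppositeToMin_iff (isLeast_support_cocircuit_of_ne_zero hfE hs.1
      (fundCocircuit_eq_zero hB hb hg (Ne.symm hbg')) (by rw [heq]; decide)), heq, hs.2.2]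

end FullyOptimal

/-! Regions bounded at `g`. -/

/-- By compliance C*(B;g) is positive at f too, so it excludes all positive circuits and not only
those avoiding f. -/
theorem IsOptimalBasis.isBoundedAt (hN : N.toMatroid.IsGenericPair f g)
    (hcomp : N.IsCompliant f g) (h : N.IsOptimalBasis g f B) : N.IsBoundedAt g := by
  have ht := h.totallyCyclic_contract hN
  rw [totallyCyclic_contract_iff] at ht
  refine ⟨?_, fun Y hY hYp hYg => ht ⟨Y, ⟨hY, hYg⟩, hYp⟩⟩
  rintro ⟨X, hX, hXp⟩
  obtain ⟨hB, hg, hf, hYp, -⟩ := h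
  have hYg := N.fundCocircuit_spec hB hg
  obtain ⟨x, hxB, hx⟩ := exists_notMem_isBase_circuit_ne_zero hB hX
  refine (N.orthogonal X hX _ hYg.1).false_of_nonneg x
    (mul_ne_zero hx (fundCocircuit_ne_zero hN hB hg
      ((N.isCircuit_support hX).subset_ground hx) hxB)) fun y => ?_
  refine SignType.mul_nonneg_of (hXp y) ?_
  by_cases hyf : y = f
  · have : N.fundCocircuit B g f ≠ -1 := fun h => hcomp ⟨_, hYg.1, hYg.2.2, h⟩
    rw [hyf]
    revert this; generalize N.fundCocircuit B g f = a; revert a; decide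
  · exact hYp y hyf

theorem IsBoundedAt.acyclic_delete (h : N.IsBoundedAt g) (f : α) : (N.delete f).Acyclic := by
  rintro ⟨X, ⟨hX, -⟩, hXp⟩
  exact h.1 ⟨X, hX, hXp⟩

theorem IsBoundedAt.totallyCyclic_contract (h : N.IsBoundedAt g) :
    (N.contract g).TotallyCyclic := by
  rw [totallyCyclic_contract_iff]
  rintro ⟨Y, ⟨hY, hYg⟩, hYp⟩
  exact h.2 Y hY hYp hYg

/-! Reorientations. -/

theorem signReorient_of_notMem {A : Set α} {x : α} (hx : x ∉ A) (X : α → SignType) :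
    signReorient A X x = X x := by
  simp [signReorient, hx]

theorem fundCircuit_reorient {A : Set α} {e : α} (heA : e ∉ A) (hB : N.toMatroid.IsBase B)
    (he : e ∈ N.toMatroid.E \ B) :
    (N.reorient A).fundCircuit B e = signReorient A (N.fundCircuit B e) := by
  obtain ⟨h1, h2, h3⟩ := N.fundCircuit_spec hB he
  refine fundCircuit_eq_of_isFundCircuit (N := N.reorient A) hB he
    ⟨⟨_, h1, rfl⟩, ?_, ?_⟩
  · rwa [support_signReorient]
  · rwa [signReorient_of_notMem heA]

theorem fundCocircuit_reorient {A : Set α} {b : α} (hbA : b ∉ A) (hB : N.toMatroid.IsBase B)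
    (hb : b ∈ B) :
    (N.reorient A).fundCocircuit B b = signReorient A (N.fundCocircuit B b) := by
  obtain ⟨h1, h2, h3⟩ := N.fundCocircuit_spec hB hb
  refine fundCocircuit_eq_of_isFundCocircuit (N := N.reorient A) hB hb
    ⟨⟨_, h1, rfl⟩, ?_, ?_⟩
  · rwa [support_signReorient]
  · rwa [signReorient_of_notMem hbA]

theorem signReorient_signErase_nonneg_iff (A : Set α) (e : α) (X : α → SignType) :
    (∀ x, 0 ≤ signReorient A (signErase e X) x) ↔ ∀ x, x ≠ e → 0 ≤ signReorient A X x := by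
  have hne : ∀ x, x ≠ e → signReorient A (signErase e X) x = signReorient A X x := by
    intro x hx
    simp [signReorient, signErase, hx]
  have he : signReorient A (signErase e X) e = 0 := by
    by_cases h : e ∈ A <;> simp [signReorient, signErase, h]
  constructor
  · intro h x hx
    rw [← hne x hx]; exact h x
  · intro h x
    by_cases hx : x = e
    · rw [hx, he]
    · rw [hne x hx]; exact h x hx

theorem isOptimalBasis_reorient_iff (hf : f ∈ N.toMatroid.E) {A : Set α} (hfA : f ∉ A)
    (hgA : g ∉ A) :
    (N.reorient A).IsOptimalBasis g f B ↔
      B ∈ N.basesWithWithout f g ∧ N.PositiveIn f g A B := by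
  constructor
  · rintro ⟨hB, hg, hfB, hY, hX⟩
    change N.toMatroid.IsBase B at hB
    rw [fundCocircuit_reorient hgA hB hg] at hY
    rw [fundCircuit_reorient hfA hB ⟨hf, hfB⟩] at hX
    exact ⟨⟨hB, hg, hfB⟩, (signReorient_signErase_nonneg_iff _ _ _).2 hY,
      (signReorient_signErase_nonneg_iff _ _ _).2 hX⟩
  · rintro ⟨⟨hB, hg, hfB⟩, hY, hX⟩
    refine ⟨hB, hg, hfB, ?_, ?_⟩
    · rw [fundCocircuit_reorient hgA hB hg]
      exact (signReorient_signErase_nonneg_iff _ _ _).1 hY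
    · rw [fundCircuit_reorient hfA hB ⟨hf, hfB⟩]
      exact (signReorient_signErase_nonneg_iff _ _ _).1 hX

theorem IsCompliant.reorient (h : N.IsCompliant f g) {A : Set α} (hf : f ∉ A) (hg : g ∉ A) :
    (N.reorient A).IsCompliant f g := by
  rintro ⟨_, ⟨Y, hY, rfl⟩, h1, h2⟩
  rw [signReorient_of_notMem hg] at h1
  rw [signReorient_of_notMem hf] at h2
  exact h ⟨Y, hY, h1, h2⟩

/-- In a compliant generic pair, a region bounded at `g` keeps the orientation of `f`. -/
theorem notMem_of_isBoundedAt_reorient (hN : N.toMatroid.IsGenericPair f g)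
    (hcomp : N.IsCompliant f g) {A : Set α} (hg : g ∉ A) (h : (N.reorient A).IsBoundedAt g) :
    f ∉ A := by
  intro hf
  -- Acyclicity leaves a positive cocircuit through f, and boundedness puts g in it. Undoing the
  -- reorientation makes it negative at f and positive at g, against compliance.
  rcases (N.reorient A).exists_positive_circuit_or_cocircuit (e := f) hN.free.mem_ground with
    ⟨X, hX, -, hXp⟩ | ⟨_, ⟨Y, hY, rfl⟩, hYf, hYp⟩
  · exact h.1 ⟨X, hX, hXp⟩
  · have h1 := h.2 _ ⟨Y, hY, rfl⟩ hYp
    have h2 := hYp g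
    rw [signReorient_of_notMem hg] at h1 h2
    have h3 : -Y f = 1 := by
      rw [← hYf]; simp [signReorient, hf]
    refine hcomp ⟨Y, hY, ?_, ?_⟩
    · revert h1 h2; generalize Y g = a; revert a; decide
    · revert h3; generalize Y f = a; revert a; decide

end OrientedMatroid

/-! ### The bijection and its comparison with the active bijection. -/

namespace OrientedMatroid

variable {α : Type*} {M N : OrientedMatroid α} {f g : α} {A B : Set α}

theorem mem_boundedRegions_iff (hN : N.toMatroid.IsGenericPair f g) (hf : f ∉ A) (hg : g ∉ A) :
    A ∈ N.boundedRegions f g ↔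
      A ⊆ N.toMatroid.E ∧ ∃ B, B ∈ N.basesWithWithout f g ∧ N.PositiveIn f g A B := by
  simp only [← isOptimalBasis_reorient_iff hN.free.mem_ground hf hg]
  constructor
  · rintro ⟨hA, -, -, ha, ht⟩
    exact ⟨hA, exists_isOptimalBasis (N := N.reorient A) hN ha ht⟩
  · rintro ⟨hA, B, hB⟩
    exact ⟨hA, hf, hg, hB.acyclic_delete (N := N.reorient A) hN,
      hB.totallyCyclic_contract (N := N.reorient A) hN⟩

theorem existsUnique_positiveIn (hN : N.toMatroid.IsGenericPair f g)
    (hA : A ∈ N.boundedRegions f g) :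
    ∃! B, B ∈ N.basesWithWithout f g ∧ N.PositiveIn f g A B := by
  obtain ⟨B, hB⟩ := ((mem_boundedRegions_iff hN hA.2.1 hA.2.2.1).1 hA).2
  refine ⟨B, hB, fun B' hB' => ?_⟩
  rw [← isOptimalBasis_reorient_iff hN.free.mem_ground hA.2.1 hA.2.2.1] at hB
  have hB'' := (isOptimalBasis_reorient_iff hN.free.mem_ground hA.2.1 hA.2.2.1).2 hB'
  exact hB''.eq (N := N.reorient A) hN hB

theorem signReorient_nonneg_iff {X : α → SignType} {x : α} (hx : X x ≠ 0) :
    0 ≤ signReorient A X x ↔ (x ∈ A ↔ X x = -1) := by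
  by_cases h : x ∈ A
  · simp only [signReorient, h, if_true, true_iff]
    revert hx; generalize X x = a; revert a; decide
  · simp only [signReorient, h, if_false, false_iff]
    revert hx; generalize X x = a; revert a; decide

theorem signReorient_eq_zero {X : α → SignType} {x : α} (hx : X x = 0) :
    signReorient A X x = 0 := by
  by_cases h : x ∈ A <;> simp [signReorient, h, hx]

/-- Outside f and g the supports of C*(B;g) and C(B;f) partition the ground set, so each element has
exactly one nonzero sign to make positive. Existence and uniqueness of A follow. -/
theorem positiveIn_iff (hN : N.toMatroid.IsGenericPair f g) (hA : A ⊆ N.toMatroid.E \ {f, g})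
    (hB : B ∈ N.basesWithWithout f g) :
    N.PositiveIn f g A B ↔ ∀ x ∈ N.toMatroid.E \ {f, g}, x ∈ A ↔
      (x ∉ B ∧ N.fundCocircuit B g x = -1 ∨ x ∈ B ∧ N.fundCircuit B f x = -1) := by
  obtain ⟨hB, hg, hf⟩ := hB
  have hfA : f ∉ A := fun h => (hA h).2 (Or.inl rfl)
  have hgA : g ∉ A := fun h => (hA h).2 (Or.inr rfl)
  have hYB := N.fundCocircuit_spec hB hg
  have hXB := N.fundCircuit_spec hB ⟨hN.free.mem_ground, hf⟩
  unfold PositiveIn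
  rw [signReorient_signErase_nonneg_iff, signReorient_signErase_nonneg_iff]
  constructor
  · rintro ⟨hY, hX⟩ x ⟨hxE, hx⟩
    have hxf : x ≠ f := fun h => hx (Or.inl h)
    have hxg : x ≠ g := fun h => hx (Or.inr h)
    by_cases hxB : x ∈ B
    · simpa [hxB] using
        (signReorient_nonneg_iff (fundCircuit_ne_zero hN hB hf hxB)).1 (hX x hxg)
    · simpa [hxB] using
        (signReorient_nonneg_iff (fundCocircuit_ne_zero hN hB hg hxE hxB)).1 (hY x hxf)
  · intro h
    constructor
    · intro x hxf
      by_cases hxg : x = g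
      · rw [hxg, signReorient_of_notMem hgA, hYB.2.2]; decide
      by_cases hxE : x ∈ N.toMatroid.E
      · by_cases hxB : x ∈ B
        · rw [signReorient_eq_zero (fundCocircuit_eq_zero hB hg hxB hxg)]
        · rw [signReorient_nonneg_iff (fundCocircuit_ne_zero hN hB hg hxE hxB)]
          simpa [hxB] using h x ⟨hxE, by rintro (h | h); exacts [hxf h, hxg h]⟩
      · rw [signReorient_eq_zero (N.cocircuit_eq_zero hYB.1 hxE)]
    · intro x hxg
      by_cases hxf : x = f
      · rw [hxf, signReorient_of_notMem hfA, hXB.2.2]; decide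
      by_cases hxB : x ∈ B
      · rw [signReorient_nonneg_iff (fundCircuit_ne_zero hN hB hf hxB)]
        simpa [hxB] using h x ⟨hB.subset_ground hxB, by rintro (h | h); exacts [hxf h, hxg h]⟩
      · have : N.fundCircuit B f x = 0 := by
          by_contra h
          exact (hXB.2.1 h).elim hxf hxB
        rw [signReorient_eq_zero this]

theorem existsUnique_reorientation (hN : N.toMatroid.IsGenericPair f g)
    (hB : B ∈ N.basesWithWithout f g) :
    ∃! A, A ⊆ N.toMatroid.E \ {f, g} ∧ N.PositiveIn f g A B := by
  let A₀ : Set α := {x | x ∈ N.toMatroid.E \ {f, g} ∧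
    (x ∉ B ∧ N.fundCocircuit B g x = -1 ∨ x ∈ B ∧ N.fundCircuit B f x = -1)}
  have hA₀ : A₀ ⊆ N.toMatroid.E \ {f, g} := fun x hx => hx.1
  refine ⟨A₀, ⟨hA₀, (positiveIn_iff hN hA₀ hB).2 fun x hx => ?_⟩, ?_⟩
  · exact ⟨fun h => h.2, fun h => ⟨hx, h⟩⟩
  · rintro A ⟨hA, hpos⟩
    have h := (positiveIn_iff hN hA hB).1 hpos
    ext x
    exact ⟨fun hx => ⟨hA hx, (h x (hA hx)).1 hx⟩, fun hx => (h x hx.1).2 hx.2⟩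

theorem mem_boundedRegions_of_positiveIn (hN : N.toMatroid.IsGenericPair f g)
    (hB : B ∈ N.basesWithWithout f g) (hA : A ⊆ N.toMatroid.E \ {f, g})
    (h : N.PositiveIn f g A B) : A ∈ N.boundedRegions f g :=
  (mem_boundedRegions_iff hN (fun h => (hA h).2 (Or.inl rfl))
    (fun h => (hA h).2 (Or.inr rfl))).2 ⟨hA.trans Set.sdiff_subset, B, hB, h⟩

theorem subset_of_mem_boundedRegions (hA : A ∈ N.boundedRegions f g) :
    A ⊆ N.toMatroid.E \ {f, g} := by
  refine fun x hx => ⟨hA.1 hx, ?_⟩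
  rintro (rfl | h)
  · exact hA.2.1 hx
  · rw [Set.mem_singleton_iff] at h
    exact hA.2.2.1 (h ▸ hx)

/-- The bijection between the bounded regions and the bases containing `g` but not `f`. -/
theorem exists_equiv_positiveIn (hN : N.toMatroid.IsGenericPair f g) :
    ∃ Φ : N.boundedRegions f g ≃ N.basesWithWithout f g,
      ∀ A B, Φ A = B ↔ N.PositiveIn f g A.1 B.1 := by
  choose F hF hFu using fun A : N.boundedRegions f g => existsUnique_positiveIn hN A.2
  have hiff : ∀ A (B : N.basesWithWithout f g), F A = B.1 ↔ N.PositiveIn f g A.1 B.1 :=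
    fun A B => ⟨fun h => h ▸ (hF A).2, fun h => (hFu A B.1 ⟨B.2, h⟩).symm⟩
  let Φ : N.boundedRegions f g → N.basesWithWithout f g := fun A => ⟨F A, (hF A).1⟩
  have hΦ : Function.Bijective Φ := by
    constructor
    · intro A A' h
      have h' : F A = F A' := congrArg Subtype.val h
      exact Subtype.ext ((existsUnique_reorientation hN (hF A).1).unique
        ⟨subset_of_mem_boundedRegions A.2, (hF A).2⟩
        ⟨subset_of_mem_boundedRegions A'.2, h' ▸ (hF A').2⟩)
    · intro B
      obtain ⟨A, ⟨hA, hpos⟩, -⟩ := existsUnique_reorientation hN B.2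
      refine ⟨⟨A, mem_boundedRegions_of_positiveIn hN B.2 hA hpos⟩, Subtype.ext ?_⟩
      exact (hiff _ B).2 hpos
  refine ⟨Equiv.ofBijective Φ hΦ, fun A B => ?_⟩
  rw [← hiff, Equiv.ofBijective_apply, Subtype.ext_iff]

theorem isOptimalBasis_reorient_iff_eq (hN : N.toMatroid.IsGenericPair f g)
    (Φ : N.boundedRegions f g ≃ N.basesWithWithout f g)
    (hΦ : ∀ A B, Φ A = B ↔ N.PositiveIn f g A.1 B.1) (A : N.boundedRegions f g) (B : Set α) :
    (N.reorient A.1).IsOptimalBasis g f B ↔ B = (Φ A).1 := by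
  rw [isOptimalBasis_reorient_iff hN.free.mem_ground A.2.2.1 A.2.2.2.1]
  constructor
  · rintro ⟨hB, h⟩
    have := (hΦ A ⟨B, hB⟩).2 h
    rw [this]
  · rintro rfl
    exact ⟨(Φ A).2, (hΦ A (Φ A)).1 rfl⟩

theorem isFullyOptimalBasis_reorient_iff [LinearOrder α] (hN : N.toMatroid.IsGenericPair f g)
    (hcomp : N.IsCompliant f g) (hgE : IsLeast N.toMatroid.E g)
    (hfE : ∀ x ∈ N.toMatroid.E, x ≠ g → f ≤ x) (hf : f ∉ A) (hg : g ∉ A) (B : Set α) :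
    (N.reorient A).IsFullyOptimalBasis B ↔ (N.reorient A).IsOptimalBasis g f B :=
  ⟨fun h => h.isOptimalBasis (N := N.reorient A) hgE hfE hN,
    fun h => h.isFullyOptimalBasis (N := N.reorient A) hgE hfE hN (hcomp.reorient hf hg)⟩

theorem mem_boundedRegions_iff_isBoundedAt (hN : N.toMatroid.IsGenericPair f g)
    (hcomp : N.IsCompliant f g) :
    A ∈ N.boundedRegions f g ↔
      A ⊆ N.toMatroid.E ∧ g ∉ A ∧ (N.reorient A).IsBoundedAt g := by
  constructor
  · rintro ⟨hA, hf, hg, ha, ht⟩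
    obtain ⟨B, hB⟩ := exists_isOptimalBasis (N := N.reorient A) hN ha ht
    exact ⟨hA, hg, hB.isBoundedAt (N := N.reorient A) hN (hcomp.reorient hf hg)⟩
  · rintro ⟨hA, hg, h⟩
    exact ⟨hA, notMem_of_isBoundedAt_reorient hN hcomp hg h, hg, h.acyclic_delete f,
      h.totallyCyclic_contract⟩

theorem activeBijection_eq [LinearOrder α] (hN : N.toMatroid.IsGenericPair f g)
    (hcomp : N.IsCompliant f g) (hgE : IsLeast N.toMatroid.E g)
    (hfE : ∀ x ∈ N.toMatroid.E, x ≠ g → f ≤ x)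
    (Φ : N.boundedRegions f g ≃ N.basesWithWithout f g)
    (hΦ : ∀ A (B : Set α), (N.reorient A.1).IsFullyOptimalBasis B ↔ B = (Φ A).1) :
    N.activeBijection = {q | ∃ A : N.boundedRegions f g, q = (A.1, (Φ A).1)} := by
  ext ⟨A, B⟩
  constructor
  · rintro ⟨hA, ⟨p, hp, hpA, hb⟩, hB⟩
    obtain rfl := hp.unique hgE
    have hmem := (mem_boundedRegions_iff_isBoundedAt hN hcomp).2 ⟨hA, hpA, hb⟩
    exact ⟨⟨A, hmem⟩, Prod.ext rfl ((hΦ ⟨A, hmem⟩ B).1 hB)⟩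
  · rintro ⟨A, h⟩
    obtain ⟨rfl, rfl⟩ := Prod.mk.inj h
    obtain ⟨hA, hg, hb⟩ := (mem_boundedRegions_iff_isBoundedAt hN hcomp).1 A.2
    exact ⟨hA, ⟨g, hgE, hg, hb⟩, (hΦ A _).2 rfl⟩

end OrientedMatroid

/-- Two signatures of a cocircuit that are orthogonal to all circuits are equal or opposite. -/
theorem eq_or_eq_neg_of_signedOrthogonal {α : Type*} {M : Matroid α} {S : Set (α → SignType)}
    (hS : IsSignature S M.IsCircuit) {Y Z : α → SignType}
    (hY : M.IsCocircuit (Function.support Y)) (hs : Function.support Y = Function.support Z)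
    (hoY : ∀ X ∈ S, SignedOrthogonal X Y) (hoZ : ∀ X ∈ S, SignedOrthogonal X Z) :
    Y = Z ∨ Y = -Z := by
  obtain ⟨a, ha⟩ := hY.nonempty
  have hs0 : ∀ x, Y x = 0 ↔ Z x = 0 := by
    intro x
    have := Set.ext_iff.1 hs x
    simp only [Function.mem_support] at this
    tauto
  -- A circuit meeting the support in exactly a and b fixes the relative sign of the two entries,
  -- for Y and Z alike.
  have key : ∀ b, Y b ≠ 0 → Y a * Z a = Y b * Z b := by
    intro b hb
    by_cases hab : a = b
    · rw [hab]
    obtain ⟨D, hD, hDK⟩ := Matroid.exists_isCocircuit_inter_eq_pair hY.isCircuit ha hb hab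
    rw [Matroid.dual_isCocircuit_iff, hS.support_iff] at hD
    obtain ⟨X, hX, rfl⟩ := hD
    have h1 := (hoY X hX).mul_eq_neg hDK
    have h2 := (hoZ X hX).mul_eq_neg (hs ▸ hDK)
    have hXa : X a ≠ 0 := (hDK.superset (Or.inl rfl)).1
    have hXb : X b ≠ 0 := (hDK.superset (Or.inr rfl)).1
    revert h1 h2 hXa hXb
    generalize X a = p
    generalize X b = q
    generalize Y a = r
    generalize Y b = s
    generalize Z a = t
    generalize Z b = u
    revert p q r s t u
    decide
  have ha' : Y a ≠ 0 := ha
  have ha0 := hs0 a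
  by_cases hsgn : Y a = Z a
  · left
    funext x
    by_cases hx : Y x = 0
    · rw [hx, (hs0 x).1 hx]
    · have hk := key x hx
      have hx0 := hs0 x
      revert hk hx0 hx hsgn ha' ha0
      generalize Y a = p
      generalize Z a = q
      generalize Y x = r
      generalize Z x = s
      revert p q r s
      decide
  · right
    funext x
    rw [Pi.neg_apply]
    by_cases hx : Y x = 0
    · rw [hx, (hs0 x).1 hx]; decide
    · have hk := key x hx
      have hx0 := hs0 x
      revert hk hx0 hx hsgn ha' ha0
      generalize Y a = p
      generalize Z a = q
      generalize Y x = r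
      generalize Z x = s
      revert p q r s
      decide

/-! ### What the deletion of f and the contraction of g determine. -/

namespace OrientedMatroid

variable {α : Type*} {M N N' : OrientedMatroid α} {f g : α} {A B : Set α}

theorem cocircuits_subset_of_circuits_eq (hm : N.toMatroid = N'.toMatroid)
    (hc : N.circuits = N'.circuits) : N.cocircuits ⊆ N'.cocircuits := by
  intro Y hY
  have hYs := N.isCocircuit_support hY
  obtain ⟨Z, hZ, hZs⟩ := (N'.cocircuits_sig.support_iff _).1 (hm ▸ hYs)
  rcases eq_or_eq_neg_of_signedOrthogonal N.circuits_sig hYs hZs.symm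
    (fun X hX => N.orthogonal X hX Y hY) (fun X hX => N'.orthogonal X (hc ▸ hX) Z hZ) with
    rfl | rfl
  · exact hZ
  · exact N'.cocircuits_sig.neg_mem Z hZ

/-- An oriented matroid is determined by its underlying matroid and its signed circuits. -/
theorem eq_of_circuits_eq (hm : N.toMatroid = N'.toMatroid) (hc : N.circuits = N'.circuits) :
    N = N' :=
  OrientedMatroid.ext hm hc ((cocircuits_subset_of_circuits_eq hm hc).antisymm
    (cocircuits_subset_of_circuits_eq hm.symm hc.symm))

theorem dual_dual (N : OrientedMatroid α) : N.dual.dual = N :=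
  OrientedMatroid.ext (Matroid.dual_dual _) rfl rfl

theorem dual_delete (N : OrientedMatroid α) (g : α) :
    N.dual.delete g = (N.contract g).dual :=
  (dual_dual _).symm

/-! The bounded regions and their bases depend only on `N \ f` and `N / g`. -/

/-- Expresses the condition through circuits of the deletion alone, so that it transfers between
oriented matroids with the same deletion. -/
theorem acyclic_delete_reorient_iff (N : OrientedMatroid α) (A : Set α) (f : α) :
    ((N.reorient A).delete f).Acyclic ↔
      ¬ ∃ X ∈ (N.delete f).circuits, ∀ x, 0 ≤ signReorient A X x := by
  refine not_congr ⟨?_, ?_⟩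
  · rintro ⟨_, ⟨⟨X, hX, rfl⟩, hXf⟩, hp⟩
    refine ⟨X, ⟨hX, ?_⟩, hp⟩
    by_contra h
    have : f ∈ Function.support (signReorient A X) := by rw [support_signReorient]; exact h
    exact this hXf
  · rintro ⟨X, ⟨hX, hXf⟩, hp⟩
    exact ⟨_, ⟨⟨X, hX, rfl⟩, signReorient_eq_zero hXf⟩, hp⟩

theorem acyclic_delete_reorient_congr (hd : N'.delete f = N.delete f) :
    ((N'.reorient A).delete f).Acyclic ↔ ((N.reorient A).delete f).Acyclic := by
  rw [acyclic_delete_reorient_iff, acyclic_delete_reorient_iff, hd]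

theorem totallyCyclic_contract_reorient_congr (hc : N'.contract g = N.contract g) :
    ((N'.reorient A).contract g).TotallyCyclic ↔ ((N.reorient A).contract g).TotallyCyclic := by
  rw [totallyCyclic_contract_iff, totallyCyclic_contract_iff]
  refine acyclic_delete_reorient_congr (N := N.dual) (N' := N'.dual) ?_
  rw [dual_delete, dual_delete, hc]

theorem ground_eq_of_delete_eq (hf : f ∈ N.toMatroid.E) (hf' : f ∈ N'.toMatroid.E)
    (hd : N'.delete f = N.delete f) : N'.toMatroid.E = N.toMatroid.E := by
  have h : N'.toMatroid.E \ {f} = N.toMatroid.E \ {f} :=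
    congrArg (fun K : OrientedMatroid α => K.toMatroid.E) hd
  have h' := congrArg (insert f) h
  rwa [Set.insert_sdiff_singleton, Set.insert_sdiff_singleton, Set.insert_eq_of_mem hf,
    Set.insert_eq_of_mem hf'] at h'

theorem boundedRegions_congr (hf : f ∈ N.toMatroid.E) (hf' : f ∈ N'.toMatroid.E)
    (hd : N'.delete f = N.delete f) (hc : N'.contract g = N.contract g) :
    N'.boundedRegions f g = N.boundedRegions f g := by
  ext A
  unfold boundedRegions
  rw [Set.mem_ofPred_eq, Set.mem_ofPred_eq, ground_eq_of_delete_eq hf hf' hd,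
    acyclic_delete_reorient_congr hd, totallyCyclic_contract_reorient_congr hc]

theorem isBase_congr_of_delete_eq (hN : N.toMatroid.IsFreeElement f)
    (hN' : N'.toMatroid.IsFreeElement f) (hd : N'.delete f = N.delete f) :
    (N'.toMatroid.IsBase B ∧ f ∉ B) ↔ (N.toMatroid.IsBase B ∧ f ∉ B) := by
  rw [← hN.delete_isBase_iff, ← hN'.delete_isBase_iff]
  exact iff_of_eq (congrArg (fun K : OrientedMatroid α => K.toMatroid.IsBase B) hd)

theorem basesWithWithout_congr (hN : N.toMatroid.IsFreeElement f)
    (hN' : N'.toMatroid.IsFreeElement f) (hd : N'.delete f = N.delete f) :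
    N'.basesWithWithout f g = N.basesWithWithout f g := by
  ext B
  have := isBase_congr_of_delete_eq (B := B) hN hN' hd
  simp only [basesWithWithout, Set.mem_ofPred_eq]
  tauto

theorem fundCircuit_congr_of_delete_eq (hf : f ∈ N.toMatroid.E) (hf' : f ∈ N'.toMatroid.E)
    (hd : N'.delete f = N.delete f) (hB : N.toMatroid.IsBase B) (hB' : N'.toMatroid.IsBase B)
    (hfB : f ∉ B) {e : α} (he : e ∈ N.toMatroid.E \ B) (hef : e ≠ f) :
    N'.fundCircuit B e = N.fundCircuit B e := by
  obtain ⟨h1, h2, h3⟩ := N.fundCircuit_spec hB he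
  refine fundCircuit_eq_of_isFundCircuit hB'
    ⟨(ground_eq_of_delete_eq hf hf' hd).symm ▸ he.1, he.2⟩ ⟨?_, h2, h3⟩
  have hmem : N.fundCircuit B e ∈ (N.delete f).circuits := by
    refine ⟨h1, ?_⟩
    by_contra h
    exact (h2 h).elim hef.symm hfB
  rw [← hd] at hmem
  exact hmem.1

/-- The entry of C*(B;g) at x outside B is minus the entry of C(B;x) at g, and for x ≠ f that
circuit avoids f. -/
theorem fundCocircuit_congr_of_delete_eq (hN : N.toMatroid.IsGenericPair f g)
    (hN' : N'.toMatroid.IsGenericPair f g) (hd : N'.delete f = N.delete f)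
    (hB : N.toMatroid.IsBase B) (hB' : N'.toMatroid.IsBase B) (hg : g ∈ B) (hf : f ∉ B)
    {x : α} (hxf : x ≠ f) : N'.fundCocircuit B g x = N.fundCocircuit B g x := by
  have hE := ground_eq_of_delete_eq hN.free.mem_ground hN'.free.mem_ground hd
  have hY := N.fundCocircuit_spec hB hg
  have hY' := N'.fundCocircuit_spec hB' hg
  by_cases hxg : x = g
  · rw [hxg, hY.2.2, hY'.2.2]
  by_cases hxE : x ∈ N.toMatroid.E
  · by_cases hxB : x ∈ B
    · rw [fundCocircuit_eq_zero hB hg hxB hxg, fundCocircuit_eq_zero hB' hg hxB hxg]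
    · rw [fundCocircuit_eq_neg_fundCircuit hB hg ⟨hxE, hxB⟩,
        fundCocircuit_eq_neg_fundCircuit hB' hg ⟨hE.symm ▸ hxE, hxB⟩,
        fundCircuit_congr_of_delete_eq hN.free.mem_ground hN'.free.mem_ground hd hB hB' hf
          ⟨hxE, hxB⟩ hxf]
  · rw [N.cocircuit_eq_zero hY.1 hxE, N'.cocircuit_eq_zero hY'.1 (hE.symm ▸ hxE)]

theorem fundCircuit_dual (hB : N.toMatroid.IsBase B) {b : α} (hb : b ∈ B) :
    N.dual.fundCircuit (N.toMatroid.E \ B) b = N.fundCocircuit B b := by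
  have hY := N.fundCocircuit_spec hB hb
  refine fundCircuit_eq_of_isFundCircuit (N := N.dual) hB.compl_isBase_dual
    ⟨hB.subset_ground hb, fun h => h.2 hb⟩ ⟨hY.1, fun x hx => ?_, hY.2.2⟩
  by_cases hxb : x = b
  · exact Or.inl hxb
  · exact Or.inr ⟨(N.isCocircuit_support hY.1).subset_ground hx,
      fun h => hx (fundCocircuit_eq_zero hB hb h hxb)⟩

theorem fundCocircuit_congr_of_contract_eq (hg : g ∈ N.toMatroid.E) (hg' : g ∈ N'.toMatroid.E)
    (hc : N'.contract g = N.contract g) (hB : N.toMatroid.IsBase B)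
    (hB' : N'.toMatroid.IsBase B) (hgB : g ∈ B) {b : α} (hb : b ∈ B) (hbg : b ≠ g) :
    N'.fundCocircuit B b = N.fundCocircuit B b := by
  have hd : N'.dual.delete g = N.dual.delete g := by rw [dual_delete, dual_delete, hc]
  have hE : N'.toMatroid.E = N.toMatroid.E :=
    ground_eq_of_delete_eq (N := N.dual) (N' := N'.dual) hg hg' hd
  rw [← fundCircuit_dual hB hb, ← fundCircuit_dual hB' hb, hE]
  exact fundCircuit_congr_of_delete_eq (N := N.dual) (N' := N'.dual) hg hg' hd
    hB.compl_isBase_dual (hE ▸ hB'.compl_isBase_dual) (fun h => h.2 hgB)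
    ⟨hB.subset_ground hb, fun h => h.2 hb⟩ hbg

/-- Entries of C(B;f) at b in B are read off C*(B;b), which avoids g when b ≠ g and so survives in
the contraction. -/
theorem fundCircuit_congr_of_contract_eq (hN : N.toMatroid.IsGenericPair f g)
    (hN' : N'.toMatroid.IsGenericPair f g) (hc : N'.contract g = N.contract g)
    (hB : N.toMatroid.IsBase B) (hB' : N'.toMatroid.IsBase B) (hg : g ∈ B) (hf : f ∉ B)
    {x : α} (hxg : x ≠ g) : N'.fundCircuit B f x = N.fundCircuit B f x := by
  have hX := N.fundCircuit_spec hB ⟨hN.free.mem_ground, hf⟩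
  have hX' := N'.fundCircuit_spec hB' ⟨hN'.free.mem_ground, hf⟩
  by_cases hxB : x ∈ B
  · have h1 := fundCocircuit_eq_neg_fundCircuit hB hxB ⟨hN.free.mem_ground, hf⟩
    have h2 := fundCocircuit_eq_neg_fundCircuit hB' hxB ⟨hN'.free.mem_ground, hf⟩
    rw [fundCocircuit_congr_of_contract_eq hN.dual_free.mem_ground hN'.dual_free.mem_ground hc
      hB hB' hg hxB hxg, h1] at h2
    exact (neg_injective h2).symm
  by_cases hxf : x = f
  · rw [hxf, hX.2.2, hX'.2.2]
  have hz : ∀ X : α → SignType, Function.support X ⊆ insert f B → X x = 0 := by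
    intro X hX
    by_contra h
    exact (hX h).elim hxf hxB
  rw [hz _ hX.2.1, hz _ hX'.2.1]

theorem positiveIn_congr (hN : N.toMatroid.IsGenericPair f g)
    (hN' : N'.toMatroid.IsGenericPair f g) (hd : N'.delete f = N.delete f)
    (hc : N'.contract g = N.contract g) (hB : B ∈ N.basesWithWithout f g) :
    N'.PositiveIn f g A B ↔ N.PositiveIn f g A B := by
  have hB' : B ∈ N'.basesWithWithout f g := by rwa [basesWithWithout_congr hN.free hN'.free hd]
  obtain ⟨hB, hg, hf⟩ := hB
  have h1 : signErase f (N'.fundCocircuit B g) = signErase f (N.fundCocircuit B g) := by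
    funext x
    by_cases hx : x = f
    · simp [signErase, hx]
    · simpa [signErase, hx] using fundCocircuit_congr_of_delete_eq hN hN' hd hB hB'.1 hg hf hx
  have h2 : signErase g (N'.fundCircuit B f) = signErase g (N.fundCircuit B f) := by
    funext x
    by_cases hx : x = g
    · simp [signErase, hx]
    · simpa [signErase, hx] using fundCircuit_congr_of_contract_eq hN hN' hc hB hB'.1 hg hf hx
  unfold PositiveIn
  rw [h1, h2]

/-! The compliant replacement of `f`: it is put infinitely close to `g`. -/

open Classical in
/-- The signed circuit obtained from the signed circuit `X` by replacing the free element `f` with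
an element near `g` (if `t = -1`) or near the opposite of `g` (if `t = 1`). -/
noncomputable def pushCircuit (t : SignType) (N : OrientedMatroid α) (f g : α)
    (X : α → SignType) : α → SignType := fun x =>
  if X f = 0 then X x
  else if X g ≠ 0 then (if x = g then t * X f else X x)
  else if x ≠ g ∧ N.fundCircuit (Function.support X \ {f}) g x ≠ 0 then
    -(t * X f * N.fundCircuit (Function.support X \ {f}) g x)
  else X x

theorem pushCircuit_of_eq_zero {t : SignType} {X : α → SignType} (h : X f = 0) :
    pushCircuit t N f g X = X := by
  funext x; simp [pushCircuit, h]

theorem pushCircuit_of_ne_zero {t : SignType} {X : α → SignType} (h : X f ≠ 0) (hg : X g ≠ 0)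
    {x : α} (hx : x ≠ g) : pushCircuit t N f g X x = X x := by
  simp [pushCircuit, h, hg, hx]

theorem pushCircuit_apply_right {t : SignType} {X : α → SignType} (h : X f ≠ 0) (hg : X g ≠ 0) :
    pushCircuit t N f g X g = t * X f := by
  simp [pushCircuit, h, hg]

theorem pushCircuit_neg (t : SignType) (X : α → SignType) :
    pushCircuit t N f g (-X) = -pushCircuit t N f g X := by
  have hz : ∀ a : SignType, -a = 0 ↔ a = 0 := by decide
  have hm : ∀ a b : SignType, -a * b = -(a * b) := by decide
  have hm' : ∀ a b : SignType, a * -b = -(a * b) := by decide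
  funext x
  unfold pushCircuit
  rw [Function.support_neg_signType]
  simp only [Pi.neg_apply, ne_eq, hz, hm, hm']
  split_ifs <;> rfl

section

variable (hf : N.toMatroid.IsFreeElement f) (hg : g ∈ N.toMatroid.E)
include hf hg

theorem isFundCircuit_support_sdiff {X : α → SignType} (hX : X ∈ N.circuits) (h : X f ≠ 0)
    (h0 : X g = 0) : N.IsFundCircuit (Function.support X \ {f}) g
      (N.fundCircuit (Function.support X \ {f}) g) :=
  N.fundCircuit_spec (hf.isBase_sdiff _ (N.isCircuit_support hX) h)
    ⟨hg, fun h => h.1 h0⟩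

/-- When X avoids g, the overwritten entries lie in C(B;g) \ g, which is contained in the basis B =
supp X \ f. They were already nonzero. -/
theorem support_pushCircuit {t : SignType} (ht : t ≠ 0) {X : α → SignType}
    (hX : X ∈ N.circuits) :
    Function.support (pushCircuit t N f g X) = Function.support X := by
  have hmul : ∀ a b : SignType, a ≠ 0 → b ≠ 0 → a * b ≠ 0 := by decide
  have hneg : ∀ a : SignType, a ≠ 0 → ¬ -a = 0 := by decide
  by_cases h : X f = 0
  · rw [pushCircuit_of_eq_zero h]
  by_cases h0 : X g = 0
  · have hG := isFundCircuit_support_sdiff hf hg hX h h0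
    ext x
    simp only [Function.mem_support, pushCircuit, h, h0, if_false, ne_eq, not_true]
    split_ifs with hc
    · have hx : X x ≠ 0 := ((hG.2.1 hc.2).resolve_left hc.1).1
      refine iff_of_true ?_ hx
      exact hneg _ (hmul _ _ (hmul _ _ ht h) hc.2)
    · rfl
  · ext x
    simp only [Function.mem_support]
    by_cases hx : x = g
    · rw [hx, pushCircuit_apply_right h h0]
      exact iff_of_true (hmul _ _ ht h) h0
    · rw [pushCircuit_of_ne_zero h h0 hx]

theorem isSignature_pushCircuit {t : SignType} (ht : t ≠ 0) :
    IsSignature (pushCircuit t N f g '' N.circuits) N.toMatroid.IsCircuit where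
  support_iff C := by
    rw [N.circuits_sig.support_iff, Set.exists_mem_image]
    constructor
    · rintro ⟨X, hX, rfl⟩
      exact ⟨X, hX, support_pushCircuit hf hg ht hX⟩
    · rintro ⟨X, hX, rfl⟩
      exact ⟨X, hX, (support_pushCircuit hf hg ht hX).symm⟩
  neg_mem := by
    rintro _ ⟨X, hX, rfl⟩
    exact ⟨-X, N.circuits_sig.neg_mem X hX, pushCircuit_neg t X⟩
  eq_or_eq_neg := by
    rintro _ ⟨X, hX, rfl⟩ _ ⟨Y, hY, rfl⟩ hs
    rw [support_pushCircuit hf hg ht hX, support_pushCircuit hf hg ht hY] at hs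
    rcases N.circuits_sig.eq_or_eq_neg X hX Y hY hs with rfl | rfl
    · exact Or.inl rfl
    · exact Or.inr (pushCircuit_neg t Y)

end

end OrientedMatroid

theorem SignedOrthogonal.of_mul_eq {α : Type*} {X Y X' Y' : α → SignType}
    (h : SignedOrthogonal X Y) (he : ∀ x, X' x * Y' x = X x * Y x) : SignedOrthogonal X' Y' := by
  simpa only [SignedOrthogonal, he] using h

theorem SignedOrthogonal.neg_left {α : Type*} {X Y : α → SignType}
    (h : SignedOrthogonal (-X) Y) : SignedOrthogonal X Y := by
  have hm : ∀ a b : SignType, (-a * b ≠ 0 ↔ a * b ≠ 0) ∧ (-a * b = 1 ↔ a * b = -1) ∧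
      (-a * b = -1 ↔ a * b = 1) := by decide
  simp only [SignedOrthogonal, Pi.neg_apply, (hm _ _).1, (hm _ _).2.1, (hm _ _).2.2] at h
  exact fun hx => (h hx).symm

/-! ### Orthogonality after the push, and the compliant extension-lifting. -/

namespace OrientedMatroid

variable {α : Type*} {M N N' : OrientedMatroid α} {f g : α} {A B : Set α}

theorem pushCircuit_of_fundCircuit_ne_zero {t : SignType} {X : α → SignType} (h : X f = 1)
    (h0 : X g = 0) {x : α} (hx : x ≠ g)
    (hG : N.fundCircuit (Function.support X \ {f}) g x ≠ 0) :
    pushCircuit t N f g X x = -(t * N.fundCircuit (Function.support X \ {f}) g x) := by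
  have h' : X f ≠ 0 := by rw [h]; decide
  unfold pushCircuit
  rw [if_neg h', if_neg (by rw [h0]; exact fun h => h rfl), if_pos ⟨hx, hG⟩, h, mul_one]

theorem pushCircuit_of_fundCircuit_eq_zero {t : SignType} {X : α → SignType}
    (h0 : X g = 0) {x : α}
    (hG : N.fundCircuit (Function.support X \ {f}) g x = 0) :
    pushCircuit t N f g X x = X x := by
  unfold pushCircuit
  by_cases h : X f = 0
  · rw [if_pos h]
  · rw [if_neg h, if_neg (by rw [h0]; exact fun h => h rfl), if_neg (fun h => h.2 hG)]

/-- Pushing a cocircuit preserves orthogonality to the circuits avoiding `f`. -/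
theorem signedOrthogonal_pushCircuit_of_eq_zero (hN : N.toMatroid.IsGenericPair f g)
    {t : SignType} (ht : t ≠ 0) {X Y : α → SignType} (hX : X ∈ N.circuits)
    (hY : Y ∈ N.cocircuits) (hXf : X f = 0) (hYg : Y g = 0 ∨ Y g = 1) :
    SignedOrthogonal X (pushCircuit t N.dual g f Y) := by
  have ho := N.orthogonal X hX Y hY
  rcases hYg with hYg | hYg
  · rwa [pushCircuit_of_eq_zero hYg]
  have hYg' : Y g ≠ 0 := by rw [hYg]; decide
  by_cases hYf : Y f = 0
  · have hG := isFundCircuit_support_sdiff (N := N.dual) (f := g) (g := f) hN.dual_free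
      hN.free.mem_ground hY hYg' hYf
    have hGne := fun x (hx : x ≠ f) => pushCircuit_of_fundCircuit_ne_zero (N := N.dual)
      (f := g) (g := f) (t := t) hYg hYf hx
    have hGeq := fun x => pushCircuit_of_fundCircuit_eq_zero (N := N.dual)
      (f := g) (g := f) (t := t) (x := x) hYf
    generalize N.dual.fundCircuit (Function.support Y \ {g}) f = G at *
    -- If X meets G, the products there are those of X and G up to the common factor -t, and
    -- orthogonality of X and G provides both signs. If not, the push changes nothing on the support
    -- of X.
    by_cases hmeet : ∃ x, X x * G x ≠ 0
    · have hval : ∀ x, X x * G x ≠ 0 →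
          X x * pushCircuit t N.dual g f Y x = -(t * (X x * G x)) := by
        intro x hx
        have hxf : x ≠ f := by rintro rfl; rw [hXf, zero_mul] at hx; exact hx rfl
        have hGx : G x ≠ 0 := fun h => hx (by rw [h, mul_zero])
        rw [hGne x hxf hGx]
        have hm : ∀ a b t : SignType, a * -(t * b) = -(t * (a * b)) := by decide
        exact hm _ _ _
      obtain ⟨⟨p, hp⟩, q, hq⟩ := N.orthogonal X hX G hG.1 hmeet
      have hp' := hval p (by rw [hp]; decide)
      have hq' := hval q (by rw [hq]; decide)
      rw [hp] at hp'
      rw [hq] at hq'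
      intro _
      have htc : t = 1 ∨ t = -1 := by
        clear * - ht
        revert t
        decide
      rcases htc with rfl | rfl
      · exact ⟨⟨q, hq'.trans (by decide)⟩, p, hp'.trans (by decide)⟩
      · exact ⟨⟨p, hp'.trans (by decide)⟩, q, hq'.trans (by decide)⟩
    · push Not at hmeet
      refine ho.of_mul_eq fun x => ?_
      by_cases hGx : G x = 0
      · rw [hGeq x hGx]
      · have : X x = 0 := by
          have := hmeet x
          revert this hGx
          generalize X x = a
          generalize G x = b
          revert a b
          decide
        rw [this, zero_mul, zero_mul]
  · refine ho.of_mul_eq fun x => ?_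
    by_cases hx : x = f
    · rw [hx, hXf, zero_mul, zero_mul]
    · rw [pushCircuit_of_ne_zero hYg' hYf hx]

/-- The pushed X follows G = C(B;g) where G is nonzero, and the pushed Y follows -H, with H the
analogous cocircuit through f. Both signs come from orthogonality of G with Y and of X with H,
except that f gives +1 if Y contains f, and g gives -1 if X contains g. -/
theorem signedOrthogonal_pushCircuit_of_eq_one (hN : N.toMatroid.IsGenericPair f g)
    {X Y : α → SignType} (hX : X ∈ N.circuits) (hY : Y ∈ N.cocircuits) (hXf : X f = 1)
    (hYg : Y g = 1) :
    SignedOrthogonal (pushCircuit (-1) N f g X) (pushCircuit 1 N.dual g f Y) := by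
  have hXf' : X f ≠ 0 := by rw [hXf]; decide
  have hYg' : Y g ≠ 0 := by rw [hYg]; decide
  have hfg := hN.ne
  by_cases hXg : X g = 0
  · have hG := isFundCircuit_support_sdiff hN.free hN.dual_free.mem_ground hX hXf' hXg
    have hGne := fun x (hx : x ≠ g) => pushCircuit_of_fundCircuit_ne_zero (N := N)
      (t := -1) hXf hXg hx
    have hGeq := fun x => pushCircuit_of_fundCircuit_eq_zero (N := N) (f := f)
      (t := -1) (x := x) hXg
    generalize N.fundCircuit (Function.support X \ {f}) g = G at *
    have hGf : G f = 0 := by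
      by_contra h
      exact (hG.2.1 h).elim hfg (fun h => h.2 rfl)
    by_cases hYf : Y f = 0
    · have hH := isFundCircuit_support_sdiff (N := N.dual) (f := g) (g := f) hN.dual_free
        hN.free.mem_ground hY hYg' hYf
      have hHne := fun x (hx : x ≠ f) => pushCircuit_of_fundCircuit_ne_zero (N := N.dual)
        (f := g) (g := f) (t := 1) hYg hYf hx
      have hHeq := fun x => pushCircuit_of_fundCircuit_eq_zero (N := N.dual)
        (f := g) (g := f) (t := 1) (x := x) hYf
      generalize N.dual.fundCircuit (Function.support Y \ {g}) f = H at *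
      have hHg : H g = 0 := by
        by_contra h
        exact (hH.2.1 h).elim hfg.symm (fun h => h.2 rfl)
      -- If G and H meet, their own orthogonality suffices, since the products there are negated. If
      -- they are disjoint, each place where G meets Y or X meets H carries the replaced value of
      -- one set and the original value of the other.
      by_cases hmeet : ∃ x, G x * H x ≠ 0
      · have hval : ∀ x, G x * H x ≠ 0 → pushCircuit (-1) N f g X x *
            pushCircuit 1 N.dual g f Y x = -(G x * H x) := by
          intro x hx
          have hGx : G x ≠ 0 := fun h => hx (by rw [h, zero_mul])
          have hHx : H x ≠ 0 := fun h => hx (by rw [h, mul_zero])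
          rw [hGne x (by rintro rfl; exact hHx hHg) hGx,
            hHne x (by rintro rfl; exact hGx hGf) hHx]
          generalize G x = a
          generalize H x = b
          revert a b
          decide
        obtain ⟨⟨p, hp⟩, q, hq⟩ := N.orthogonal G hG.1 H hH.1 hmeet
        have hp' := hval p (by rw [hp]; decide)
        have hq' := hval q (by rw [hq]; decide)
        rw [hp] at hp'
        rw [hq] at hq'
        exact fun _ => ⟨⟨q, hq'.trans (by decide)⟩, p, hp'⟩
      · push Not at hmeet
        have hdis : ∀ x, G x = 0 ∨ H x = 0 := by
          intro x
          have := hmeet x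
          revert this
          generalize G x = a
          generalize H x = b
          revert a b
          decide
        obtain ⟨p, hp⟩ := (N.orthogonal G hG.1 Y hY).exists_eq_neg_one (e := g)
          (by rw [hG.2.2, hYg]; decide)
        obtain ⟨q, hq⟩ := (N.orthogonal X hX H hH.1).exists_eq_neg_one (e := f)
          (by rw [hH.2.2, hXf]; decide)
        refine fun _ => ⟨⟨q, ?_⟩, p, ?_⟩
        · have hHq : H q ≠ 0 := by
            rintro h; rw [h, mul_zero] at hq; exact absurd hq (by decide)
          have hqf : q ≠ f := by
            rintro rfl; rw [hXf, hH.2.2] at hq; exact absurd hq (by decide)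
          rw [hGeq q ((hdis q).resolve_right hHq), hHne q hqf hHq]
          revert hq
          generalize X q = a
          generalize H q = b
          revert a b
          decide
        · have hGp : G p ≠ 0 := by
            rintro h; rw [h, zero_mul] at hp; exact absurd hp (by decide)
          have hpg : p ≠ g := by
            rintro rfl; rw [hYg, hG.2.2] at hp; exact absurd hp (by decide)
          rw [hHeq p ((hdis p).resolve_left hGp), hGne p hpg hGp]
          revert hp
          generalize Y p = a
          generalize G p = b
          revert a b
          decide
    · obtain ⟨p, hp⟩ := (N.orthogonal G hG.1 Y hY).exists_eq_neg_one (e := g)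
        (by rw [hG.2.2, hYg]; decide)
      refine fun _ => ⟨⟨f, ?_⟩, p, ?_⟩
      · rw [hGeq f hGf, pushCircuit_apply_right hYg' hYf, hXf, hYg]; decide
      · have hGp : G p ≠ 0 := by
          rintro h; rw [h, zero_mul] at hp; exact absurd hp (by decide)
        have hpg : p ≠ g := by
          rintro rfl; rw [hYg, hG.2.2] at hp; exact absurd hp (by decide)
        have hpf : p ≠ f := by rintro rfl; exact hGp hGf
        rw [hGne p hpg hGp, pushCircuit_of_ne_zero hYg' hYf hpf]
        revert hp
        generalize Y p = a
        generalize G p = b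
        revert a b
        decide
  · by_cases hYf : Y f = 0
    · have hH := isFundCircuit_support_sdiff (N := N.dual) (f := g) (g := f) hN.dual_free
        hN.free.mem_ground hY hYg' hYf
      have hHne := fun x (hx : x ≠ f) => pushCircuit_of_fundCircuit_ne_zero (N := N.dual)
        (f := g) (g := f) (t := 1) hYg hYf hx
      have hHeq := fun x => pushCircuit_of_fundCircuit_eq_zero (N := N.dual)
        (f := g) (g := f) (t := 1) (x := x) hYf
      generalize N.dual.fundCircuit (Function.support Y \ {g}) f = H at *
      have hHg : H g = 0 := by
        by_contra h
        exact (hH.2.1 h).elim hfg.symm (fun h => h.2 rfl)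
      obtain ⟨q, hq⟩ := (N.orthogonal X hX H hH.1).exists_eq_neg_one (e := f)
        (by rw [hH.2.2, hXf]; decide)
      refine fun _ => ⟨⟨q, ?_⟩, g, ?_⟩
      · have hHq : H q ≠ 0 := by
          rintro h; rw [h, mul_zero] at hq; exact absurd hq (by decide)
        have hqf : q ≠ f := by
          rintro rfl; rw [hXf, hH.2.2] at hq; exact absurd hq (by decide)
        have hqg : q ≠ g := by rintro rfl; exact hHq hHg
        rw [hHne q hqf hHq, pushCircuit_of_ne_zero hXf' hXg hqg]
        revert hq
        generalize X q = a
        generalize H q = b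
        revert a b
        decide
      · rw [hHeq g hHg, pushCircuit_apply_right hXf' hXg, hXf, hYg]; decide
    · refine fun _ => ⟨⟨f, ?_⟩, g, ?_⟩
      · rw [pushCircuit_of_ne_zero hXf' hXg hfg, pushCircuit_apply_right hYg' hYf, hXf, hYg]
        decide
      · rw [pushCircuit_apply_right hXf' hXg, pushCircuit_of_ne_zero hYg' hYf hfg.symm, hXf, hYg]
        decide

theorem signedOrthogonal_pushCircuit (hN : N.toMatroid.IsGenericPair f g)
    {X Y : α → SignType} (hX : X ∈ N.circuits) (hY : Y ∈ N.cocircuits) :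
    SignedOrthogonal (pushCircuit (-1) N f g X) (pushCircuit 1 N.dual g f Y) := by
  have hcase : ∀ a : SignType, (a = 0 ∨ a = 1) ∨ (-a = 0 ∨ -a = 1) := by decide
  wlog hXf : X f = 0 ∨ X f = 1 generalizing X
  · refine SignedOrthogonal.neg_left ?_
    rw [← pushCircuit_neg]
    exact this (N.circuits_sig.neg_mem X hX) ((hcase _).resolve_left hXf)
  wlog hYg : Y g = 0 ∨ Y g = 1 generalizing Y
  · refine (SignedOrthogonal.neg_left ?_).symm
    rw [← pushCircuit_neg]
    exact (this (N.cocircuits_sig.neg_mem Y hY) ((hcase _).resolve_left hYg)).symm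
  rcases hXf with hXf | hXf
  · rw [pushCircuit_of_eq_zero hXf]
    exact signedOrthogonal_pushCircuit_of_eq_zero hN (by decide) hX hY hXf hYg
  rcases hYg with hYg | hYg
  · rw [pushCircuit_of_eq_zero hYg]
    have h := signedOrthogonal_pushCircuit_of_eq_zero (N := N.dual) hN.dual (t := -1) (by decide)
      hY hX hYg (Or.inr hXf)
    rw [dual_dual] at h
    exact h.symm
  · exact signedOrthogonal_pushCircuit_of_eq_one hN hX hY hXf hYg

/-- The oriented matroid obtained from `N` by replacing `f` with an element near `g`, with the
same intersection with `g`. -/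
noncomputable def pushToward (N : OrientedMatroid α) (f g : α)
    (hN : N.toMatroid.IsGenericPair f g) : OrientedMatroid α where
  toMatroid := N.toMatroid
  circuits := pushCircuit (-1) N f g '' N.circuits
  cocircuits := pushCircuit 1 N.dual g f '' N.cocircuits
  ground_finite := N.ground_finite
  circuits_sig := isSignature_pushCircuit hN.free hN.dual_free.mem_ground (by decide)
  cocircuits_sig := isSignature_pushCircuit (N := N.dual) hN.dual_free hN.free.mem_ground
    (by decide)
  orthogonal := by
    rintro _ ⟨X, hX, rfl⟩ _ ⟨Y, hY, rfl⟩
    exact signedOrthogonal_pushCircuit hN hX hY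

theorem circuits_pushCircuit_of_eq_zero (hf : N.toMatroid.IsFreeElement f)
    (hg : g ∈ N.toMatroid.E) {t : SignType} (ht : t ≠ 0) :
    {X | X ∈ pushCircuit t N f g '' N.circuits ∧ X f = 0} = {X | X ∈ N.circuits ∧ X f = 0} := by
  ext X
  constructor
  · rintro ⟨⟨X, hX, rfl⟩, h⟩
    have hXf : X f = 0 := by
      by_contra hXf
      have : f ∈ Function.support (pushCircuit t N f g X) := by
        rw [support_pushCircuit hf hg ht hX]; exact hXf
      exact this h
    rw [pushCircuit_of_eq_zero hXf]
    exact ⟨hX, hXf⟩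
  · rintro ⟨hX, hXf⟩
    exact ⟨⟨X, hX, pushCircuit_of_eq_zero hXf⟩, hXf⟩

/-- Circuits avoiding f are untouched and no other circuit loses f; the signed cocircuits then agree
automatically, being determined by the circuits. -/
theorem delete_pushToward (hN : N.toMatroid.IsGenericPair f g) :
    (N.pushToward f g hN).delete f = N.delete f :=
  eq_of_circuits_eq rfl
    (circuits_pushCircuit_of_eq_zero hN.free hN.dual_free.mem_ground (by decide))

theorem contract_pushToward (hN : N.toMatroid.IsGenericPair f g) :
    (N.pushToward f g hN).contract g = N.contract g := by
  refine congrArg dual (?_ : (N.pushToward f g hN).dual.delete g = N.dual.delete g)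
  exact eq_of_circuits_eq rfl
    (circuits_pushCircuit_of_eq_zero (N := N.dual) hN.dual_free hN.free.mem_ground
      (by decide))

/-- A pushed cocircuit through g either misses f or has there the same sign as at g; this is the
choice t = 1. -/
theorem isCompliant_pushToward (hN : N.toMatroid.IsGenericPair f g) :
    (N.pushToward f g hN).IsCompliant f g := by
  rintro ⟨_, ⟨Y, hY, rfl⟩, h1, h2⟩
  by_cases hYg : Y g = 0
  · rw [pushCircuit_of_eq_zero hYg, hYg] at h1
    exact absurd h1 (by decide)
  by_cases hYf : Y f = 0
  · have h3 : f ∈ Function.support (pushCircuit 1 N.dual g f Y) := by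
      rw [Function.mem_support, h2]; decide
    rw [support_pushCircuit (N := N.dual) hN.dual_free hN.free.mem_ground (by decide)
      hY] at h3
    exact h3 hYf
  · rw [pushCircuit_of_ne_zero hYg hYf hN.ne.symm] at h1
    rw [pushCircuit_apply_right hYg hYf, h1] at h2
    exact absurd h2 (by decide)

end OrientedMatroid

/-! ### The proposition. -/

theorem proposition3 {α : Type*} (M N : OrientedMatroid α) (f g : α)
    (hN : M.IsGenericExtensionLifting N f g) :
    -- each bounded region has a unique basis
    (∀ A ∈ N.boundedRegions f g, ∃! B, B ∈ N.basesWithWithout f g ∧ N.PositiveIn f g A B) ∧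
    -- each basis determines a reorientation, and it is a bounded region
    (∀ B ∈ N.basesWithWithout f g,
      (∃! A, A ⊆ N.toMatroid.E \ {f, g} ∧ N.PositiveIn f g A B) ∧
      ∀ A ⊆ N.toMatroid.E \ {f, g}, N.PositiveIn f g A B → A ∈ N.boundedRegions f g) ∧
    -- the resulting bijection
    (∃ Φ : N.boundedRegions f g ≃ N.basesWithWithout f g,
      (∀ A B, Φ A = B ↔ N.PositiveIn f g A.1 B.1) ∧
      -- the unique optimal basis
      (∀ A (B : Set α), (N.reorient A.1).IsOptimalBasis g f B ↔ B = (Φ A).1) ∧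
      -- the compliant case
      (N.IsCompliant f g → ∀ [LinearOrder α], g < f →
        (∀ e ∈ N.toMatroid.E \ {f, g}, f < e) →
        (∀ A (B : Set α), (N.reorient A.1).IsFullyOptimalBasis B ↔ B = (Φ A).1) ∧
        N.activeBijection = {q | ∃ A : N.boundedRegions f g, q = (A.1, (Φ A).1)})) ∧
    -- replacement of `f` by a compliant one with the same intersection with `g`
    (∃ N' : OrientedMatroid α, M.IsGenericExtensionLifting N' f g ∧ N'.IsCompliant f g ∧
      N'.delete f = N.delete f ∧ N'.contract g = N.contract g) ∧
    (∀ N' : OrientedMatroid α, M.IsGenericExtensionLifting N' f g → N'.IsCompliant f g →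
      N'.delete f = N.delete f → N'.contract g = N.contract g →
      N'.boundedRegions f g = N.boundedRegions f g ∧
      N'.basesWithWithout f g = N.basesWithWithout f g ∧
      ∀ A ∈ N.boundedRegions f g, ∀ B ∈ N.basesWithWithout f g,
        (N'.PositiveIn f g A B ↔ N.PositiveIn f g A B)) := by
  have hG := hN.isGenericPair
  have hfE := hG.free.mem_ground
  refine ⟨fun A hA => OrientedMatroid.existsUnique_positiveIn hG hA, fun B hB =>
    ⟨OrientedMatroid.existsUnique_reorientation hG hB, fun A hA h =>
      OrientedMatroid.mem_boundedRegions_of_positiveIn hG hB hA h⟩, ?_,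
    ⟨N.pushToward f g hG, OrientedMatroid.isGenericExtensionLifting_iff_of_eq hN rfl
      (OrientedMatroid.delete_pushToward hG) (OrientedMatroid.contract_pushToward hG),
      OrientedMatroid.isCompliant_pushToward hG, OrientedMatroid.delete_pushToward hG,
      OrientedMatroid.contract_pushToward hG⟩, ?_⟩
  · obtain ⟨Φ, hΦ⟩ := OrientedMatroid.exists_equiv_positiveIn hG
    have hopt := OrientedMatroid.isOptimalBasis_reorient_iff_eq hG Φ hΦ
    refine ⟨Φ, hΦ, hopt, fun hcomp _ hgf hlt => ?_⟩
    have hf : ∀ x ∈ N.toMatroid.E, x ≠ g → f ≤ x := by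
      intro x hx hxg
      by_cases hxf : x = f
      · exact hxf.ge
      · exact (hlt x ⟨hx, by rintro (h | h); exacts [hxf h, hxg h]⟩).le
    have hg : IsLeast N.toMatroid.E g := by
      refine ⟨hG.dual_free.mem_ground, fun x hx => ?_⟩
      by_cases hxg : x = g
      · exact hxg.ge
      · exact hgf.le.trans (hf x hx hxg)
    have hfull : ∀ A (B : Set α), (N.reorient A.1).IsFullyOptimalBasis B ↔ B = (Φ A).1 :=
      fun A B => (OrientedMatroid.isFullyOptimalBasis_reorient_iff hG hcomp hg hf A.2.2.1
        A.2.2.2.1 B).trans (hopt A B)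
    exact ⟨hfull, OrientedMatroid.activeBijection_eq hG hcomp hg hf Φ hfull⟩
  · intro N' hN' _ hd hc
    have hG' := hN'.isGenericPair
    exact ⟨OrientedMatroid.boundedRegions_congr hfE hG'.free.mem_ground hd hc,
      OrientedMatroid.basesWithWithout_congr hG.free hG'.free hd,
      fun A _ B hB => OrientedMatroid.positiveIn_congr hG hG' hd hc hB⟩
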